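/- **Theorem 5.1.** Let $k$ be a field, let $S = k[x,y,z,w]$, and let $I = \langle x^2, xy, y^2z^2, zw, w^2\rangle \subseteq S$. A monomial ideal is strongly generic if no variable appears with the same nonzero exponent in two distinct minimal monomial generators. For a set $W$ of minimal monomial generators of $I$ put $m_W = \operatorname{lcm}(m : m\in W)$. The Scarf complex $\Delta_I$ consists of those $W$ such that $m_V \ne m_W$ for every other set $V \neq W$ of minimal generators. The algebraic Scarf complex of $I$ (with respect to a total order $\prec$ on the monomials) is the complex of free $S$-modules with basis $\{g_W : W\in\Delta_I\}$, where $g_W$ has homological degree $\#W$ and internal degree $\deg m_W$, and with differential $$\partial g_W=\sum_{m\in W}(-1)^{\#\{m'\in W\,:\,m'\prec m\}}\frac{m_W}{m_{W\setminus\{m\}}}\,g_{W\setminus\{m\}}.$$ Then: 1. $I$ is strongly generic. 2. For every choice of $\prec$, the algebraic Scarf complex of $I$ is a minimal free resolution of $S/I$, graded with respect to the standard $\mathbb{Z}$-grading. 3. Let $\mathbb{F} = \bigoplus_i \mathbb{F}_i$ be any minimal $\mathbb{Z}$-graded free resolution of $S/I$ with $\mathbb{F}_0=S$. Then $\mathbb{F}$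 admits no differential graded algebra structure whose multiplication respects the standard $\mathbb{Z}$-grading. That is, there is no $S$-bilinear map $* : \mathbb{F}\times\mathbb{F}\to\mathbb{F}$ such that, for elements $a,b,c$ that are homogeneous with respect to the homological degree $|\cdot|$: $*$ extends the multiplication of $\mathbb{F}_0=S$; $\partial(a*b)=\partial a*b+(-1)^{|a|}a*\partial b$; $|a*b|=|a|+|b|$; $a*b=(-1)^{|a||b|}b*a$; $(a*b)*c=a*(b*c)$; and $*$ adds internal degrees. -/

import Mathlib

open MvPolynomial

universe v w

/-! ### Monomial ideals

Monomials of `k[x_i : i ∈ σ]` are represented by their exponent vectors `σ →₀ ℕ`; divisibility is the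
componentwise order and the least common multiple is the componentwise supremum. -/

/-- `G(I)`: the exponent vectors of the minimal monomial generators of a monomial ideal `I`, that is
the monomials in `I` that are minimal with respect to divisibility. -/
def minimalGenerators {σ k : Type*} [Field k] (I : Ideal (MvPolynomial σ k)) : Set (σ →₀ ℕ) :=
  {m | Minimal (fun a : σ →₀ ℕ => monomial a (1 : k) ∈ I) m}

/-- An ideal generated by monomials. -/
def IsMonomialIdeal {σ k : Type*} [Field k] (I : Ideal (MvPolynomial σ k)) : Prop :=
  ∃ A : Set (σ →₀ ℕ), I = Ideal.span ((fun a => monomial a (1 : k)) '' A)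

/-- A monomial ideal is strongly generic if no variable appears with the same nonzero exponent in two
distinct minimal monomial generators. -/
def IsStronglyGeneric {σ k : Type*} [Field k] (I : Ideal (MvPolynomial σ k)) : Prop :=
  IsMonomialIdeal I ∧
    ∀ m ∈ minimalGenerators I, ∀ m' ∈ minimalGenerators I, m ≠ m' → ∀ i, m i ≠ 0 → m i ≠ m' i

/-! ### Graded free resolutions and DGA structures -/

/-- The data of a `ℤ`-graded complex `F = ⨁ F_i` of free modules over `S = k[x_i : i ∈ σ]`, given
through a homogeneous basis `B`, so that `F = B →₀ S`. The basis element `b` has homological degree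
`hdeg b` and internal degree `deg b`; `d` is the differential, and `one` is a distinguished basis
element, meant to be the generator `1` of `F_0 = S`.
The conditions on these data are in `IsMinimalFreeResolution`. -/
structure GradedFreeComplex.{u, u1, u2} (σ : Type u) (k : Type u1) [Field k] where
  B : Type u2
  hdeg : B → ℕ
  deg : B → ℤ
  one : B
  d : (B →₀ MvPolynomial σ k) →ₗ[MvPolynomial σ k] (B →₀ MvPolynomial σ k)

namespace GradedFreeComplex

variable {σ k : Type*} [Field k] (C : GradedFreeComplex σ k)

/-- The underlying free module `F = ⨁ F_i`. -/
abbrev Total := C.B →₀ MvPolynomial σ k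

/-- The component `F_i` of homological degree `i`. -/
noncomputable def hpart (i : ℕ) : Submodule (MvPolynomial σ k) C.Total :=
  Finsupp.supported (MvPolynomial σ k) (MvPolynomial σ k) {b | C.hdeg b = i}

/-- `f` is homogeneous of degree `n` for the standard `ℤ`-grading (every variable has degree `1`,
the basis element `b` has degree `deg b`). Zero is homogeneous of every degree. -/
def IsHomogeneousOfDegree (f : C.Total) (n : ℤ) : Prop :=
  ∀ b, IsWeightedHomogeneous (fun _ : σ => (1 : ℤ)) (f b) (n - C.deg b)

/-- `C` is a minimal `ℤ`-graded free resolution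
`… → F_2 → F_1 → F_0 = S → S/I → 0` of `S/I`. -/
structure IsMinimalFreeResolution (I : Ideal (MvPolynomial σ k)) : Prop where
  /-- `F_0` is free of rank one on the generator `one`, which has degree `0`, i.e. `F_0 = S`. -/
  hdeg_eq_zero_iff : ∀ b, C.hdeg b = 0 ↔ b = C.one
  deg_one : C.deg C.one = 0
  /-- The differential lowers the homological degree by one. -/
  d_hpart_zero : ∀ f ∈ C.hpart 0, C.d f = 0
  d_hpart_succ : ∀ i, ∀ f ∈ C.hpart (i + 1), C.d f ∈ C.hpart i
  /-- The differential respects the `ℤ`-grading. -/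
  d_homogeneous : ∀ f n, C.IsHomogeneousOfDegree f n → C.IsHomogeneousOfDegree (C.d f) n
  /-- The image of `F_1` in `F_0 = S` is `I`. -/
  mem_iff : ∀ p, p ∈ I ↔ ∃ g ∈ C.hpart 1, C.d g = Finsupp.single C.one p
  /-- Exactness at `F_{i+1}`: cycles are the same as boundaries. -/
  exact : ∀ i, ∀ f ∈ C.hpart (i + 1), C.d f = 0 ↔ ∃ g ∈ C.hpart (i + 2), C.d g = f
  /-- Minimality: the image of `d` lies in `𝔪 F`, where `𝔪` is generated by the variables. -/
  minimal : ∀ f b, C.d f b ∈ Ideal.span (Set.range (X : σ → MvPolynomial σ k))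

/-- A differential graded algebra structure on `F`: an `S`-bilinear multiplication that extends the
multiplication on `F_0 = S`, satisfies the Leibniz rule, is homogeneous for the homological grading,
graded-commutative and associative. -/
structure IsDGA (mul : C.Total →ₗ[MvPolynomial σ k] C.Total →ₗ[MvPolynomial σ k] C.Total) :
    Prop where
  extends_mul : ∀ p q : MvPolynomial σ k,
    mul (Finsupp.single C.one p) (Finsupp.single C.one q) = Finsupp.single C.one (p * q)
  leibniz : ∀ i, ∀ a ∈ C.hpart i, ∀ b,
    C.d (mul a b) = mul (C.d a) b + (-1 : MvPolynomial σ k) ^ i • mul a (C.d b)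
  mul_hpart : ∀ i j, ∀ a ∈ C.hpart i, ∀ b ∈ C.hpart j, mul a b ∈ C.hpart (i + j)
  graded_comm : ∀ i j, ∀ a ∈ C.hpart i, ∀ b ∈ C.hpart j,
    mul a b = (-1 : MvPolynomial σ k) ^ (i * j) • mul b a
  assoc : ∀ a b c, mul (mul a b) c = mul a (mul b c)

/-- The multiplication respects the standard `ℤ`-grading. -/
def RespectsGrading
    (mul : C.Total →ₗ[MvPolynomial σ k] C.Total →ₗ[MvPolynomial σ k] C.Total) : Prop :=
  ∀ a b m n, C.IsHomogeneousOfDegree a m → C.IsHomogeneousOfDegree b n →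
    C.IsHomogeneousOfDegree (mul a b) (m + n)

end GradedFreeComplex

/-! ### The algebraic Scarf complex -/

/-- The exponent vector of `m_W = lcm(m : m ∈ W)`. -/
noncomputable def lcmExp {σ : Type*} (W : Finset (σ →₀ ℕ)) : σ →₀ ℕ := W.sup id

/-- `W` is a face of the Scarf complex of `I`: it is a finite set of minimal generators, and no other
such set has the same least common multiple. -/
def IsScarfFace {σ k : Type*} [Field k] (I : Ideal (MvPolynomial σ k)) (W : Finset (σ →₀ ℕ)) :
    Prop :=
  (W : Set (σ →₀ ℕ)) ⊆ minimalGenerators I ∧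
    ∀ V : Finset (σ →₀ ℕ), (V : Set (σ →₀ ℕ)) ⊆ minimalGenerators I → lcmExp V = lcmExp W → V = W

open Classical in
/-- Faces of faces are faces. -/
theorem IsScarfFace.erase {σ k : Type*} [Field k] {I : Ideal (MvPolynomial σ k)}
    {W : Finset (σ →₀ ℕ)} (hW : IsScarfFace I W) (m : σ →₀ ℕ) : IsScarfFace I (W.erase m) := by
  by_cases hm : m ∈ W
  · refine ⟨fun a ha => hW.1 (Finset.mem_of_mem_erase ha), fun V hV hVW => ?_⟩
    have h1 : insert m V = W := by
      refine hW.2 _ ?_ ?_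
      · intro a ha
        rcases Finset.mem_insert.1 ha with rfl | ha
        · exact hW.1 hm
        · exact hV ha
      · have h2 : lcmExp (insert m (W.erase m)) = lcmExp W := by rw [Finset.insert_erase hm]
        rw [← h2]
        simp only [lcmExp, Finset.sup_insert] at hVW ⊢
        rw [hVW]
    by_cases hmV : m ∈ V
    · rw [Finset.insert_eq_of_mem hmV] at h1
      subst h1
      have h3 := hW.2 (V.erase m) (fun a ha => hV (Finset.mem_of_mem_erase ha)) hVW.symm
      exact h3.symm
    · rw [← h1, Finset.erase_insert hmV]
  · rwa [Finset.erase_eq_of_notMem hm]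

open Classical in
/-- The empty set is the only set of generators of a proper ideal whose least common multiple is `1`. -/
theorem isScarfFace_empty {σ k : Type*} [Field k] {I : Ideal (MvPolynomial σ k)} (hI : I ≠ ⊤) :
    IsScarfFace I ∅ := by
  refine ⟨by simp, fun V hV h => Finset.eq_empty_of_forall_notMem fun a ha => hI ?_⟩
  have h0 : a = 0 := by
    have h1 : a ≤ lcmExp V := Finset.le_sup (f := id) ha
    rw [h] at h1
    simpa [lcmExp, ← bot_eq_zero] using h1
  have h2 : monomial a (1 : k) ∈ I := (hV ha).1
  rw [h0] at h2
  exact (Ideal.eq_top_iff_one I).2 h2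

open Classical in
/-- The algebraic Scarf complex of `S/I` for a proper ideal `I`, i.e. the subcomplex of the Taylor
resolution spanned by the basis elements `g_W` with `W` in the Scarf complex. Here `lt` is the chosen
strict total order on the monomials (which only affects signs), `g_W` has homological degree `#W` and
internal degree the total degree of `m_W`, and
`d g_W = ∑ m ∈ W, (-1) ^ #{m' ∈ W | lt m' m} * (m_W / m_{W \ m}) g_{W \ m}`. -/
noncomputable def algebraicScarfComplex {σ k : Type*} [Field k] (lt : (σ →₀ ℕ) → (σ →₀ ℕ) → Prop)
    (I : Ideal (MvPolynomial σ k)) (hI : I ≠ ⊤) : GradedFreeComplex σ k where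
  B := {W : Finset (σ →₀ ℕ) // IsScarfFace I W}
  hdeg W := W.1.card
  deg W := ((lcmExp W.1).degree : ℤ)
  one := ⟨∅, isScarfFace_empty hI⟩
  d := Finsupp.linearCombination (MvPolynomial σ k) fun W =>
    ∑ m ∈ W.1, Finsupp.single ⟨W.1.erase m, W.2.erase m⟩
      ((-1) ^ (W.1.filter fun m' => lt m' m).card *
        monomial (lcmExp W.1 - lcmExp (W.1.erase m)) (1 : k))

/-! ### The homogeneous maximal ideal -/

/-! Write a, b, c, d, e for the five generators in the given order, indexed by 0, …, 4 in the code.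
The Scarf complex has facets {a,b,d,e} and {b,c,d}. In multidegree u its algebraic complex is the
simplicial chain complex of the faces with lcm dividing u. For every monomial u of I these faces
form a cone, and joining with the apex is a contracting homotopy (`scarf_isMinimalFreeResolution`).
Minimality holds because distinct faces have distinct lcms.

For the third claim, minimal graded resolutions are unique up to an isomorphism that is the identity
on F_0 (`exists_isGradedIso`), so it suffices to exclude a multiplication on one Scarf complex. All
generators except c have degree 2, while F_3 starts in degree 5 and F_4 in degree 6. Hence products
in F_2 of degree 4 and in F_3 of degree 5 are determined by their boundaries (`eq_of_d_eq`): for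
instance g_a g_b = x g_ab, g_d g_e = w g_de, g_ab g_e = g_abe and g_a g_de = g_ade. The products
with c are known only up to boundaries: g_a g_c = yz² g_ab + x g_bc + ∂T and g_c g_e = y²z g_de + w
g_cd + ∂U.

Associativity and the known products put ∂T · g_e and g_a · ∂U into (x,w)F for all T and U in F_3.
Comparing (g_a g_c) g_e with g_a (g_c g_e) modulo (x,w) then gives yz² g_abe = y²z g_ade, which is
absurd for distinct basis elements (`kat_not_isDGA`). -/

theorem mem_span_range_X_iff {σ k : Type*} [Field k] (p : MvPolynomial σ k) :
    p ∈ Ideal.span (Set.range (X : σ → MvPolynomial σ k)) ↔ coeff 0 p = 0 := by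
  have h := mem_pow_idealOfVars_iff (σ := σ) (R := k) 1 p
  rw [pow_one] at h
  refine Iff.trans h ⟨fun h0 => ?_, fun h0 x hx => ?_⟩
  · by_contra hne
    have := h0 0 (mem_support_iff.2 hne)
    simp at this
  · rw [Nat.one_le_iff_ne_zero, Ne, Finsupp.degree_eq_zero_iff]
    rintro rfl
    exact (mem_support_iff.1 hx) h0

theorem weight_one_eq_degree {σ : Type*} (μ : σ →₀ ℕ) :
    Finsupp.weight (fun _ : σ => (1 : ℤ)) μ = (μ.degree : ℤ) := by
  rw [Finsupp.weight_apply, Finsupp.degree_apply, Finsupp.sum]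
  simp

/-- A Krull intersection statement by degree count: monomials of an element of 𝔪^n have degree at
least n. No finiteness of `σ` is needed. -/
theorem eq_zero_of_mem_pow_idealOfVars {σ k : Type*} [Field k] {p : MvPolynomial σ k}
    (h : ∀ n, p ∈ idealOfVars σ k ^ n) : p = 0 := by
  rw [← support_eq_empty, Finset.eq_empty_iff_forall_notMem]
  intro x hx
  have := (mem_pow_idealOfVars_iff _ _).1 (h (x.degree + 1)) x hx
  omega

/-! ### Graded linear algebra on free modules with a homogeneous basis. -/

namespace GradedFreeComplex

variable {σ k : Type*} [Field k]

section Homogeneous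

variable (C : GradedFreeComplex σ k)

/-- The basis element `b` of the free module `F`. -/
noncomputable abbrev gen (b : C.B) : C.Total := Finsupp.single b 1

variable {C}

theorem single_eq_smul_gen (b : C.B) (p : MvPolynomial σ k) :
    (Finsupp.single b p : C.Total) = p • C.gen b := by simp

theorem map_eq_sum {M : Type*} [AddCommGroup M] [Module (MvPolynomial σ k) M]
    (φ : C.Total →ₗ[MvPolynomial σ k] M) (f : C.Total) :
    φ f = ∑ b ∈ f.support, f b • φ (C.gen b) := by
  conv_lhs => rw [← Finsupp.sum_single f, Finsupp.sum, map_sum]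
  exact Finset.sum_congr rfl fun b _ => by rw [single_eq_smul_gen, map_smul]

theorem gen_mem_hpart (b : C.B) : C.gen b ∈ C.hpart (C.hdeg b) :=
  Finsupp.single_mem_supported _ _ rfl

/-- A homogeneous element with coordinates in `𝔪` involves only basis elements of lower degree. -/
theorem IsHomogeneousOfDegree.deg_lt {f : C.Total} {n : ℤ} (hf : C.IsHomogeneousOfDegree f n)
    {b : C.B} (hb : f b ≠ 0) (hm : f b ∈ Ideal.span (Set.range (X : σ → MvPolynomial σ k))) :
    C.deg b < n := by
  obtain ⟨μ, hμ⟩ := ne_zero_iff.1 hb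
  have h1 := hf b hμ
  have h2 : μ ≠ 0 := by
    rintro rfl
    exact hμ ((mem_span_range_X_iff _).1 hm)
  have h4 : μ.degree ≠ 0 := by rwa [Ne, Finsupp.degree_eq_zero_iff]
  rw [weight_one_eq_degree] at h1
  omega

/-- A nonzero coordinate of a homogeneous element has nonnegative degree. -/
theorem IsHomogeneousOfDegree.deg_le {f : C.Total} {n : ℤ} (hf : C.IsHomogeneousOfDegree f n)
    {b : C.B} (hb : f b ≠ 0) : C.deg b ≤ n := by
  obtain ⟨μ, hμ⟩ := ne_zero_iff.1 hb
  have h1 := hf b hμ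
  rw [weight_one_eq_degree] at h1
  omega

theorem IsHomogeneousOfDegree.zero (n : ℤ) : C.IsHomogeneousOfDegree 0 n :=
  fun _ => isWeightedHomogeneous_zero _ _ _

theorem IsHomogeneousOfDegree.add {f g : C.Total} {n : ℤ} (hf : C.IsHomogeneousOfDegree f n)
    (hg : C.IsHomogeneousOfDegree g n) : C.IsHomogeneousOfDegree (f + g) n :=
  fun b => (hf b).add (hg b)

theorem IsHomogeneousOfDegree.sub {f g : C.Total} {n : ℤ} (hf : C.IsHomogeneousOfDegree f n)
    (hg : C.IsHomogeneousOfDegree g n) : C.IsHomogeneousOfDegree (f - g) n :=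
  fun b => (hf b).sub (hg b)

theorem IsHomogeneousOfDegree.sum {ι : Type*} {s : Finset ι} {f : ι → C.Total} {n : ℤ}
    (hf : ∀ i ∈ s, C.IsHomogeneousOfDegree (f i) n) :
    C.IsHomogeneousOfDegree (∑ i ∈ s, f i) n := by
  classical
  induction s using Finset.induction_on with
  | empty => exact .zero n
  | insert a s ha ih =>
    rw [Finset.sum_insert ha]
    exact (hf a (by simp)).add (ih fun i hi => hf i (by simp [hi]))

theorem IsHomogeneousOfDegree.smul {f : C.Total} {n m l : ℤ} {p : MvPolynomial σ k}
    (hp : IsWeightedHomogeneous (fun _ : σ => (1 : ℤ)) p m) (hf : C.IsHomogeneousOfDegree f n)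
    (hl : l = m + n) : C.IsHomogeneousOfDegree (p • f) l := fun b => by
  have := hp.mul (hf b)
  rwa [show l - C.deg b = m + (n - C.deg b) by rw [hl]; ring]

theorem isHomogeneousOfDegree_single {b : C.B} {p : MvPolynomial σ k} {m n : ℤ}
    (hp : IsWeightedHomogeneous (fun _ : σ => (1 : ℤ)) p m) (hn : n = m + C.deg b) :
    C.IsHomogeneousOfDegree (Finsupp.single b p) n := fun c => by
  classical
  rw [Finsupp.single_apply]
  split_ifs with h
  · subst h
    rwa [hn, add_sub_cancel_right]
  · exact isWeightedHomogeneous_zero _ _ _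

theorem isHomogeneousOfDegree_gen (b : C.B) : C.IsHomogeneousOfDegree (C.gen b) (C.deg b) :=
  isHomogeneousOfDegree_single (isWeightedHomogeneous_one _ _) (by simp)

/-- The homogeneous component of degree `n`. -/
noncomputable def component (n : ℤ) : C.Total →ₗ[k] C.Total :=
  Finsupp.lsum k fun b => (Finsupp.lsingle (R := k) b) ∘ₗ
    weightedHomogeneousComponent (fun _ : σ => (1 : ℤ)) (n - C.deg b)

theorem component_single (n : ℤ) (b : C.B) (p : MvPolynomial σ k) :
    component n (Finsupp.single b p : C.Total) = Finsupp.single b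
      (weightedHomogeneousComponent (fun _ : σ => (1 : ℤ)) (n - C.deg b) p) := by
  simp [component]

theorem component_apply (n : ℤ) (f : C.Total) (b : C.B) :
    component n f b =
      weightedHomogeneousComponent (fun _ : σ => (1 : ℤ)) (n - C.deg b) (f b) := by
  classical
  induction f using Finsupp.induction_linear with
  | zero => simp
  | add f g hf hg => rw [map_add, Finsupp.add_apply, hf, hg, Finsupp.add_apply, map_add]
  | single c p =>
    rw [component_single, Finsupp.single_apply, Finsupp.single_apply]
    split_ifs with h
    · rw [h]
    · simp

theorem component_isHomogeneous (n : ℤ) (f : C.Total) :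
    C.IsHomogeneousOfDegree (component n f) n := fun b => by
  rw [component_apply]
  exact weightedHomogeneousComponent_isWeightedHomogeneous _ (f b)

theorem IsHomogeneousOfDegree.component_same {f : C.Total} {n : ℤ}
    (hf : C.IsHomogeneousOfDegree f n) : component n f = f := by
  ext1 b
  rw [component_apply]
  exact weightedHomogeneousComponent_eq_self (hf b)

theorem IsHomogeneousOfDegree.component_ne {f : C.Total} {n m : ℤ}
    (hf : C.IsHomogeneousOfDegree f n) (h : m ≠ n) : component m f = 0 := by
  ext1 b
  rw [component_apply]
  exact (hf b).weightedHomogeneousComponent_ne _ (by simpa using h)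

theorem component_mem_hpart {i : ℕ} (n : ℤ) {f : C.Total} (hf : f ∈ C.hpart i) :
    component n f ∈ C.hpart i := by
  rw [hpart, Finsupp.mem_supported'] at hf ⊢
  intro b hb
  rw [component_apply, hf b hb, map_zero]

/-- An endomorphism of `F_i` that is idempotent and has image in `𝔪 F_i` vanishes. -/
theorem eq_zero_of_idempotent_of_mem {i : ℕ} {N : C.Total →ₗ[MvPolynomial σ k] C.Total}
    (hi : ∀ f ∈ C.hpart i, N f ∈ C.hpart i) (hN : ∀ f ∈ C.hpart i, N (N f) = N f)
    (hm : ∀ f ∈ C.hpart i, ∀ b, N f b ∈ idealOfVars σ k) {f : C.Total} (hf : f ∈ C.hpart i) :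
    N f = 0 := by
  -- Since `N f = N (N f)`, every further application of `N` gains a factor in 𝔪. This replaces
  -- Nakayama's lemma when the basis may be infinite.
  have key : ∀ n : ℕ, ∀ f ∈ C.hpart i, ∀ b, N f b ∈ idealOfVars σ k ^ n := by
    intro n
    induction n with
    | zero => intro f _ b; simp
    | succ n ih =>
      intro f hf b
      rw [← hN f hf, map_eq_sum N (N f), Finsupp.finsetSum_apply]
      refine Ideal.sum_mem _ fun c hc => ?_
      rw [Finsupp.smul_apply, smul_eq_mul, pow_succ']
      exact Ideal.mul_mem_mul (hm f hf c)
        (ih _ (Finsupp.single_mem_supported _ _ (hi f hf hc)) _)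
  ext1 b
  exact eq_zero_of_mem_pow_idealOfVars fun n => key n f hf b

end Homogeneous

section Maps

universe u₁ u₂ u₃ u₄

variable {σ : Type u₁} {k : Type u₂} [Field k] {C : GradedFreeComplex.{u₁, u₂, u₃} σ k}
  {C' : GradedFreeComplex.{u₁, u₂, u₄} σ k}

/-- Linear maps of internal degree zero. -/
def PreservesDegree (φ : C.Total →ₗ[MvPolynomial σ k] C'.Total) : Prop :=
  ∀ f n, C.IsHomogeneousOfDegree f n → C'.IsHomogeneousOfDegree (φ f) n

theorem preservesDegree_of_gen {φ : C.Total →ₗ[MvPolynomial σ k] C'.Total}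
    (h : ∀ b, C'.IsHomogeneousOfDegree (φ (C.gen b)) (C.deg b)) : PreservesDegree φ := by
  intro f n hf
  rw [map_eq_sum]
  refine IsHomogeneousOfDegree.sum fun b _ => ?_
  exact (h b).smul (hf b) (by ring)

theorem PreservesDegree.component {φ : C.Total →ₗ[MvPolynomial σ k] C'.Total}
    (h : PreservesDegree φ) (n : ℤ) (f : C.Total) :
    component n (φ f) = φ (component n f) := by
  induction f using Finsupp.induction_linear with
  | zero => simp
  | add f g hf hg => rw [map_add, map_add, map_add, map_add, hf, hg]
  | single b p =>
    induction p using MvPolynomial.induction_on' with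
    | add p q hp hq => rw [Finsupp.single_add, map_add, map_add, map_add, map_add, hp, hq]
    | monomial c a =>
      have hs : C.IsHomogeneousOfDegree (Finsupp.single b (monomial c a))
          (Finsupp.weight (fun _ : σ => (1 : ℤ)) c + C.deg b) :=
        isHomogeneousOfDegree_single (isWeightedHomogeneous_monomial _ _ _ rfl) rfl
      by_cases hn : n = Finsupp.weight (fun _ : σ => (1 : ℤ)) c + C.deg b
      · subst hn
        rw [(h _ _ hs).component_same, hs.component_same]
      · rw [(h _ _ hs).component_ne hn, hs.component_ne hn, map_zero]

/-- A linear map that agrees on each `F_i` with `φ i`. -/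
noncomputable def glue (φ : ℕ → C.Total →ₗ[MvPolynomial σ k] C'.Total) :
    C.Total →ₗ[MvPolynomial σ k] C'.Total :=
  Finsupp.linearCombination _ fun b => φ (C.hdeg b) (C.gen b)

theorem glue_gen (φ : ℕ → C.Total →ₗ[MvPolynomial σ k] C'.Total) (b : C.B) :
    glue φ (C.gen b) = φ (C.hdeg b) (C.gen b) := by simp [glue]

theorem eq_on_hpart {φ ψ : C.Total →ₗ[MvPolynomial σ k] C'.Total} {i : ℕ}
    (h : ∀ b, C.hdeg b = i → φ (C.gen b) = ψ (C.gen b)) {f : C.Total} (hf : f ∈ C.hpart i) :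
    φ f = ψ f := by
  rw [map_eq_sum φ, map_eq_sum ψ]
  exact Finset.sum_congr rfl fun b hb => by rw [h b (hf hb)]

theorem glue_eq (φ : ℕ → C.Total →ₗ[MvPolynomial σ k] C'.Total) {i : ℕ} {f : C.Total}
    (hf : f ∈ C.hpart i) : glue φ f = φ i f :=
  eq_on_hpart (fun b hb => by rw [glue_gen, hb]) hf

theorem map_mem_of_gen {φ : C.Total →ₗ[MvPolynomial σ k] C'.Total} {i : ℕ}
    {M : Submodule (MvPolynomial σ k) C'.Total}
    (h : ∀ b, C.hdeg b = i → φ (C.gen b) ∈ M) {f : C.Total} (hf : f ∈ C.hpart i) :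
    φ f ∈ M := by
  rw [map_eq_sum]
  refine Submodule.sum_mem _ fun b hb => ?_
  exact M.smul_mem _ (h b (hf hb))

end Maps

end GradedFreeComplex

/-! ### Comparison of two minimal resolutions, one homological degree at a time. -/

namespace GradedFreeComplex

universe u₁ u₂ u₃ u₄

variable {σ : Type u₁} {k : Type u₂} [Field k] {C : GradedFreeComplex.{u₁, u₂, u₃} σ k}
  {C' : GradedFreeComplex.{u₁, u₂, u₄} σ k} {I : Ideal (MvPolynomial σ k)}

namespace IsMinimalFreeResolution

theorem mem_hpart_zero_iff (hC : C.IsMinimalFreeResolution I) {f : C.Total} :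
    f ∈ C.hpart 0 ↔ f = Finsupp.single C.one (f C.one) := by
  constructor
  · intro hf
    ext1 b
    classical
    rw [Finsupp.single_apply]
    split_ifs with h
    · rw [h]
    · exact (Finsupp.mem_supported' _ _).1 hf b fun h' => h ((hC.hdeg_eq_zero_iff b).1 h').symm
  · intro hf
    rw [hf]
    exact Finsupp.single_mem_supported _ _ ((hC.hdeg_eq_zero_iff _).2 rfl)

/-- The differential commutes with homogeneous components, so any preimage may be replaced by its
component of degree `n`. -/
theorem exists_homogeneous_preimage (hC : C.IsMinimalFreeResolution I) {i : ℕ} {n : ℤ}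
    {f : C.Total} (hf : C.IsHomogeneousOfDegree f n) (h : ∃ g ∈ C.hpart i, C.d g = f) :
    ∃ g ∈ C.hpart i, C.IsHomogeneousOfDegree g n ∧ C.d g = f := by
  obtain ⟨g, hg, rfl⟩ := h
  refine ⟨component n g, component_mem_hpart n hg, component_isHomogeneous n g, ?_⟩
  rw [← PreservesDegree.component (C := C) (C' := C) hC.d_homogeneous, hf.component_same]

/-- A basis element that is a cycle would be a boundary, but its coordinate 1 is not in 𝔪. -/
theorem d_gen_ne_zero (hC : C.IsMinimalFreeResolution I) {i : ℕ} {b : C.B}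
    (hb : C.hdeg b = i + 1) : C.d (C.gen b) ≠ 0 := by
  intro h
  obtain ⟨g, -, hg⟩ := (hC.exact i _ (hb ▸ gen_mem_hpart b)).1 h
  have := hC.minimal g b
  rw [hg, mem_span_range_X_iff] at this
  simp at this

/-- The basis elements of `F_i` have internal degree at least `i`. -/
theorem hdeg_le_deg (hC : C.IsMinimalFreeResolution I) (b : C.B) : (C.hdeg b : ℤ) ≤ C.deg b := by
  generalize hi : C.hdeg b = i
  induction i generalizing b with
  | zero =>
    rw [(hC.hdeg_eq_zero_iff b).1 hi, hC.deg_one]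
    rfl
  | succ i ih =>
    -- Some `c` in `F_i` occurs in the boundary, and minimality makes its degree strictly smaller.
    obtain ⟨c, hc⟩ := Finsupp.ne_iff.1 (hC.d_gen_ne_zero hi)
    have hci : C.hdeg c = i :=
      hC.d_hpart_succ i _ (hi ▸ gen_mem_hpart b) (Finsupp.mem_support_iff.2 hc)
    have h1 := (hC.d_homogeneous _ _ (isHomogeneousOfDegree_gen b)).deg_lt hc (hC.minimal _ c)
    have h2 := ih c hci
    push_cast
    omega

end IsMinimalFreeResolution

/-- `φ` identifies `F_i` with `F'_i`, compatibly with the grading and with the boundaries. -/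
structure IsPartIso (C : GradedFreeComplex.{u₁, u₂, u₃} σ k)
    (C' : GradedFreeComplex.{u₁, u₂, u₄} σ k) (i : ℕ)
    (φ : C.Total →ₗ[MvPolynomial σ k] C'.Total) : Prop where
  map_hpart : ∀ f ∈ C.hpart i, φ f ∈ C'.hpart i
  homogeneous_gen : ∀ b, C.hdeg b = i → C'.IsHomogeneousOfDegree (φ (C.gen b)) (C.deg b)
  injective : ∀ f ∈ C.hpart i, φ f = 0 → f = 0
  surjective : ∀ g ∈ C'.hpart i, ∃ f ∈ C.hpart i, φ f = g
  boundary_iff : ∀ f ∈ C.hpart i,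
    (∃ g ∈ C.hpart (i + 1), C.d g = f) ↔ ∃ g ∈ C'.hpart (i + 1), C'.d g = φ f

theorem IsPartIso.homogeneous {i : ℕ} {φ : C.Total →ₗ[MvPolynomial σ k] C'.Total}
    (h : IsPartIso C C' i φ) {f : C.Total} {n : ℤ} (hf : f ∈ C.hpart i)
    (hn : C.IsHomogeneousOfDegree f n) : C'.IsHomogeneousOfDegree (φ f) n := by
  rw [map_eq_sum]
  exact IsHomogeneousOfDegree.sum fun b hb =>
    (h.homogeneous_gen b (hf hb)).smul (hn b) (by ring)

namespace IsMinimalFreeResolution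

theorem exists_isPartIso_zero (hC : C.IsMinimalFreeResolution I)
    (hC' : C'.IsMinimalFreeResolution I) :
    ∃ φ : C.Total →ₗ[MvPolynomial σ k] C'.Total, IsPartIso C C' 0 φ ∧
      φ (C.gen C.one) = C'.gen C'.one := by
  let φ : C.Total →ₗ[MvPolynomial σ k] C'.Total :=
    Finsupp.linearCombination _ fun _ => C'.gen C'.one
  have hφ : ∀ b p, φ (Finsupp.single b p) = Finsupp.single C'.one p := by simp [φ]
  refine ⟨φ, ⟨?_, ?_, ?_, ?_, ?_⟩, hφ _ _⟩
  · intro f hf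
    rw [hC.mem_hpart_zero_iff.1 hf, hφ, hC'.mem_hpart_zero_iff]
    simp
  · intro b hb
    obtain rfl := (hC.hdeg_eq_zero_iff b).1 hb
    rw [gen, hφ]
    exact isHomogeneousOfDegree_single (isWeightedHomogeneous_one _ _)
      (by rw [hC.deg_one, hC'.deg_one]; rfl)
  · intro f hf h
    rw [hC.mem_hpart_zero_iff.1 hf] at h ⊢
    rw [hφ, Finsupp.single_eq_zero] at h
    rw [h, Finsupp.single_zero]
  · intro g hg
    refine ⟨Finsupp.single C.one (g C'.one), hC.mem_hpart_zero_iff.2 (by simp), ?_⟩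
    rw [hφ, ← hC'.mem_hpart_zero_iff.1 hg]
  · intro f hf
    rw [hC.mem_hpart_zero_iff.1 hf, hφ]
    exact (hC.mem_iff _).symm.trans (hC'.mem_iff _)

/-- Lift `φ ∘ d` through the second differential to get `ψ`. Surjectivity is a graded Nakayama
argument; injectivity comes from an idempotent whose image consists of boundaries. At the new level
`boundary_iff` is exactness: cycles correspond because `φ` is injective. -/
theorem exists_isPartIso_succ (hC : C.IsMinimalFreeResolution I)
    (hC' : C'.IsMinimalFreeResolution I) {i : ℕ} {φ : C.Total →ₗ[MvPolynomial σ k] C'.Total}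
    (hφ : IsPartIso C C' i φ) :
    ∃ ψ : C.Total →ₗ[MvPolynomial σ k] C'.Total, IsPartIso C C' (i + 1) ψ ∧
      ∀ f ∈ C.hpart (i + 1), C'.d (ψ f) = φ (C.d f) := by
  classical
  have hlift : ∀ b, ∃ g, C'.IsHomogeneousOfDegree g (C.deg b) ∧
      (C.hdeg b = i + 1 → g ∈ C'.hpart (i + 1) ∧ C'.d g = φ (C.d (C.gen b))) := by
    intro b
    by_cases hb : C.hdeg b = i + 1
    · have hb' : C.gen b ∈ C.hpart (i + 1) := hb ▸ gen_mem_hpart b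
      have hd := hC.d_hpart_succ i _ hb'
      obtain ⟨g, hg, hgd, h⟩ := hC'.exists_homogeneous_preimage
        (hφ.homogeneous hd (hC.d_homogeneous _ _ (isHomogeneousOfDegree_gen b)))
        ((hφ.boundary_iff _ hd).1 ⟨_, hb', rfl⟩)
      exact ⟨g, hgd, fun _ => ⟨hg, h⟩⟩
    · exact ⟨0, .zero _, fun h => absurd h hb⟩
  choose l hl using hlift
  let ψ : C.Total →ₗ[MvPolynomial σ k] C'.Total := Finsupp.linearCombination _ l
  have hψg : ∀ b, ψ (C.gen b) = l b := by simp [ψ]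
  have hψh : ∀ f ∈ C.hpart (i + 1), ψ f ∈ C'.hpart (i + 1) := fun f hf =>
    map_mem_of_gen (fun b hb => by rw [hψg]; exact ((hl b).2 hb).1) hf
  have hψd : ∀ f ∈ C.hpart (i + 1), C'.d (ψ f) = φ (C.d f) := fun f hf =>
    eq_on_hpart (φ := C'.d ∘ₗ ψ) (ψ := φ ∘ₗ C.d)
      (fun b hb => by simpa [hψg] using ((hl b).2 hb).2) hf
  have hψdeg : PreservesDegree ψ := preservesDegree_of_gen fun b => by rw [hψg]; exact (hl b).1
  have hcycle : ∀ f ∈ C.hpart (i + 1), C'.d (ψ f) = 0 ↔ C.d f = 0 := by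
    intro f hf
    rw [hψd f hf]
    exact ⟨hφ.injective _ (hC.d_hpart_succ i f hf), fun h => by rw [h, map_zero]⟩
  -- Surjectivity modulo 𝔪: the boundary of `gen c` pulls back under `φ` to some `d g`, so `gen c -
  -- ψ g` is a cycle, hence a boundary, hence has coordinates in 𝔪. Passing to a component makes `g`
  -- homogeneous.
  have hsurj1 : ∀ c, C'.hdeg c = i + 1 → ∃ f ∈ C.hpart (i + 1),
      C.IsHomogeneousOfDegree f (C'.deg c) ∧ ∀ b, C'.gen c b - ψ f b ∈ idealOfVars σ k := by
    intro c hc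
    have hc' : C'.gen c ∈ C'.hpart (i + 1) := hc ▸ gen_mem_hpart c
    obtain ⟨f, hf, hfc⟩ := hφ.surjective _ (hC'.d_hpart_succ i _ hc')
    obtain ⟨g, hg, hgf⟩ := (hφ.boundary_iff f hf).2 ⟨_, hc', hfc.symm⟩
    have hg' := component_mem_hpart (C'.deg c) hg
    refine ⟨component (C'.deg c) g, hg', component_isHomogeneous _ _, ?_⟩
    have hz : C'.d (C'.gen c - ψ (component (C'.deg c) g)) = 0 := by
      rw [← hψdeg.component, ← (isHomogeneousOfDegree_gen c).component_same, ← map_sub,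
        ← PreservesDegree.component (C := C') (C' := C') hC'.d_homogeneous, map_sub, hψd g hg,
        hgf, hfc, sub_self, map_zero]
    obtain ⟨t, -, ht⟩ := (hC'.exact i _ (Submodule.sub_mem _ hc' (hψh _ hg'))).1 hz
    intro b
    rw [← Finsupp.sub_apply, ← ht]
    exact hC'.minimal t b
  -- Induction on the internal degree: the error left by `hsurj1` involves only basis elements of
  -- smaller degree. The induction starts because degrees are bounded below by `hdeg_le_deg`.
  have hsurj2 : ∀ n : ℕ, ∀ c, C'.hdeg c = i + 1 → C'.deg c ≤ n →
      ∃ f ∈ C.hpart (i + 1), ψ f = C'.gen c := by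
    intro n
    induction n with
    | zero =>
      intro c hc hn
      have := hC'.hdeg_le_deg c
      push_cast at hn
      omega
    | succ n ih =>
      intro c hc hn
      obtain ⟨f, hf, hfd, hfm⟩ := hsurj1 c hc
      have hr : C'.gen c - ψ f ∈ C'.hpart (i + 1) :=
        Submodule.sub_mem _ (hc ▸ gen_mem_hpart c) (hψh f hf)
      have hrd : C'.IsHomogeneousOfDegree (C'.gen c - ψ f) (C'.deg c) :=
        (isHomogeneousOfDegree_gen c).sub (hψdeg f _ hfd)
      have hsub : C'.gen c - ψ f ∈ (C.hpart (i + 1)).map ψ := by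
        rw [← LinearMap.id_apply (R := MvPolynomial σ k) (C'.gen c - ψ f), map_eq_sum]
        refine Submodule.sum_mem _ fun b hb => Submodule.smul_mem _ _ ?_
        refine ih b (hr hb) ?_
        have h1 := hrd.deg_lt (Finsupp.mem_support_iff.1 hb) (hfm b)
        push_cast at hn
        omega
      obtain ⟨g, hg, hgf⟩ := hsub
      exact ⟨g + f, Submodule.add_mem _ hg hf, by rw [map_add, hgf, sub_add_cancel]⟩
  have hsurj3 : ∀ c, ∃ f, C'.hdeg c = i + 1 → f ∈ C.hpart (i + 1) ∧ ψ f = C'.gen c := by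
    intro c
    by_cases hc : C'.hdeg c = i + 1
    · obtain ⟨f, hf⟩ := hsurj2 (C'.deg c).toNat c hc (Int.self_le_toNat _)
      exact ⟨f, fun _ => hf⟩
    · exact ⟨0, fun h => absurd h hc⟩
  choose r hr using hsurj3
  let ρ : C'.Total →ₗ[MvPolynomial σ k] C.Total := Finsupp.linearCombination _ r
  have hρg : ∀ c, ρ (C'.gen c) = r c := by simp [ρ]
  have hρh : ∀ g ∈ C'.hpart (i + 1), ρ g ∈ C.hpart (i + 1) := fun f hf =>
    map_mem_of_gen (fun b hb => by rw [hρg]; exact (hr b hb).1) hf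
  have hψρ : ∀ g ∈ C'.hpart (i + 1), ψ (ρ g) = g := fun g hg =>
    eq_on_hpart (φ := ψ ∘ₗ ρ) (ψ := LinearMap.id)
      (fun b hb => by simpa [hρg] using (hr b hb).2) hg
  refine ⟨ψ, ⟨hψh, fun b hb => by rw [hψg]; exact (hl b).1, ?_,
    fun g hg => ⟨ρ g, hρh g hg, hψρ g hg⟩, ?_⟩, hψd⟩
  · intro f hf hf0
    -- `N` projects onto the kernel of `ψ` along the section `ρ`. Its image consists of cycles, thus
    -- of boundaries, and so lies in 𝔪F.
    let N : C.Total →ₗ[MvPolynomial σ k] C.Total := LinearMap.id - ρ ∘ₗ ψ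
    have hN : ∀ f, N f = f - ρ (ψ f) := fun f => rfl
    have hNm : ∀ f ∈ C.hpart (i + 1), N f ∈ C.hpart (i + 1) := fun f hf =>
      Submodule.sub_mem _ hf (hρh _ (hψh _ hf))
    have hψN : ∀ f ∈ C.hpart (i + 1), ψ (N f) = 0 := fun f hf => by
      rw [hN, map_sub, hψρ _ (hψh _ hf), sub_self]
    have hNfix : ∀ f, ψ f = 0 → N f = f := fun f h => by rw [hN, h, map_zero, sub_zero]
    rw [← hNfix f hf0]
    refine eq_zero_of_idempotent_of_mem hNm (fun f hf => hNfix _ (hψN f hf)) (fun f hf b => ?_) hf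
    obtain ⟨t, -, ht⟩ := (hC.exact i _ (hNm f hf)).1
      ((hcycle _ (hNm f hf)).1 (by rw [hψN f hf, map_zero]))
    rw [← ht]
    exact hC.minimal t b
  · intro f hf
    exact (hC.exact i f hf).symm.trans ((hcycle f hf).symm.trans (hC'.exact i _ (hψh f hf)))

end IsMinimalFreeResolution

end GradedFreeComplex

/-! ### Uniqueness of minimal resolutions, and transport of DGA structures. -/

namespace GradedFreeComplex

universe u₁ u₂ u₃ u₄

variable {σ : Type u₁} {k : Type u₂} [Field k] {C : GradedFreeComplex.{u₁, u₂, u₃} σ k}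
  {C' : GradedFreeComplex.{u₁, u₂, u₄} σ k} {I : Ideal (MvPolynomial σ k)}

/-- Isomorphisms of graded complexes over the identity of `F_0 = S`. -/
structure IsGradedIso (Φ : C.Total ≃ₗ[MvPolynomial σ k] C'.Total) : Prop where
  d_comm : ∀ f, C'.d (Φ f) = Φ (C.d f)
  map_hpart : ∀ i, ∀ f ∈ C.hpart i, Φ f ∈ C'.hpart i
  symm_hpart : ∀ i, ∀ f ∈ C'.hpart i, Φ.symm f ∈ C.hpart i
  degree : PreservesDegree (C := C) (C' := C') Φ.toLinearMap
  symm_degree : PreservesDegree (C := C') (C' := C) Φ.symm.toLinearMap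
  map_one : ∀ p, Φ (Finsupp.single C.one p) = Finsupp.single C'.one p

/-- Minimal graded free resolutions are unique up to isomorphism. -/
theorem IsMinimalFreeResolution.exists_isGradedIso (hC : C.IsMinimalFreeResolution I)
    (hC' : C'.IsMinimalFreeResolution I) :
    ∃ Φ : C.Total ≃ₗ[MvPolynomial σ k] C'.Total, IsGradedIso Φ := by
  obtain ⟨φ₀, hφ₀, hone⟩ := hC.exists_isPartIso_zero hC'
  choose next hnext using fun (i : ℕ) (φ : {φ // IsPartIso C C' i φ}) =>
    hC.exists_isPartIso_succ hC' φ.2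
  let φ : ∀ i, {φ // IsPartIso C C' i φ} :=
    Nat.rec ⟨φ₀, hφ₀⟩ fun i φ => ⟨next i φ, (hnext i φ).1⟩
  have hφ := fun i => (φ i).2
  have hφd : ∀ i, ∀ f ∈ C.hpart (i + 1), C'.d ((φ (i + 1)).1 f) = (φ i).1 (C.d f) :=
    fun i => (hnext i (φ i)).2
  let Φ : C.Total →ₗ[MvPolynomial σ k] C'.Total := glue fun i => (φ i).1
  have hΦ : ∀ i, ∀ f ∈ C.hpart i, Φ f = (φ i).1 f := fun i f hf => glue_eq _ hf
  have hΦg : ∀ b, Φ (C.gen b) = (φ (C.hdeg b)).1 (C.gen b) := glue_gen _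
  have hΦh : ∀ i, ∀ f ∈ C.hpart i, Φ f ∈ C'.hpart i := fun i f hf =>
    hΦ i f hf ▸ (hφ i).map_hpart f hf
  choose r hr using fun c => (hφ (C'.hdeg c)).surjective _ (gen_mem_hpart c)
  let Ψ : C'.Total →ₗ[MvPolynomial σ k] C.Total := Finsupp.linearCombination _ r
  have hΨg : ∀ c, Ψ (C'.gen c) = r c := by simp [Ψ]
  have hΨh : ∀ i, ∀ f ∈ C'.hpart i, Ψ f ∈ C.hpart i := fun i f hf =>
    map_mem_of_gen (fun b hb => by rw [hΨg]; exact hb ▸ (hr b).1) hf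
  have hΦΨg : ∀ c, Φ (Ψ (C'.gen c)) = C'.gen c := fun c => by
    rw [hΨg, hΦ _ _ (hr c).1, (hr c).2]
  have hΦΨ : ∀ f, Φ (Ψ f) = f := fun f => by
    rw [← LinearMap.comp_apply, map_eq_sum]
    conv_rhs => rw [← LinearMap.id_apply (R := MvPolynomial σ k) f, map_eq_sum]
    exact Finset.sum_congr rfl fun c _ => by rw [LinearMap.comp_apply, hΦΨg, LinearMap.id_apply]
  have hΨΦg : ∀ b, Ψ (Φ (C.gen b)) = C.gen b := fun b => by
    have hm := gen_mem_hpart b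
    have hm' := Submodule.sub_mem _ (hΨh _ _ (hΦh _ _ hm)) hm
    refine sub_eq_zero.1 ((hφ _).injective _ hm' ?_)
    rw [← hΦ _ _ hm', map_sub, hΦΨ, sub_self]
  have hΨΦ : ∀ f, Ψ (Φ f) = f := fun f => by
    rw [← LinearMap.comp_apply, map_eq_sum]
    conv_rhs => rw [← LinearMap.id_apply (R := MvPolynomial σ k) f, map_eq_sum]
    exact Finset.sum_congr rfl fun c _ => by rw [LinearMap.comp_apply, hΨΦg, LinearMap.id_apply]
  have hdeg : PreservesDegree Φ := preservesDegree_of_gen fun b => by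
    rw [hΦg]
    exact (hφ _).homogeneous_gen b rfl
  refine ⟨LinearEquiv.ofLinearMap Φ Ψ (LinearMap.ext hΦΨ) (LinearMap.ext hΨΦ),
    ?_, hΦh, hΨh, hdeg, ?_, ?_⟩
  · intro f
    change C'.d (Φ f) = Φ (C.d f)
    rw [← LinearMap.comp_apply C'.d, ← LinearMap.comp_apply Φ, map_eq_sum,
      map_eq_sum (Φ ∘ₗ C.d)]
    refine Finset.sum_congr rfl fun b _ => ?_
    congr 1
    rw [LinearMap.comp_apply, LinearMap.comp_apply]
    have hm := gen_mem_hpart b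
    generalize C.hdeg b = i at hm
    cases i with
    | zero => rw [hC.d_hpart_zero _ hm, hC'.d_hpart_zero _ (hΦh _ _ hm), map_zero]
    | succ i => rw [hΦ _ _ hm, hφd i _ hm, hΦ _ _ (hC.d_hpart_succ i _ hm)]
  · intro f n hf
    change C.IsHomogeneousOfDegree (Ψ f) n
    -- Both sides have the same image under `Φ`, which commutes with components.
    have h : component n (Ψ f) = Ψ f := by
      rw [← hΨΦ (component n (Ψ f)), ← hdeg.component, hΦΨ, hf.component_same]
    rw [← h]
    exact component_isHomogeneous n _
  · intro p
    change Φ _ = _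
    have h0 : C.hdeg C.one = 0 := (hC.hdeg_eq_zero_iff _).2 rfl
    rw [single_eq_smul_gen, single_eq_smul_gen, map_smul, hΦ 0 _ (h0 ▸ gen_mem_hpart _)]
    exact congrArg (p • ·) hone

/-- DGA structures can be transported along isomorphisms. -/
theorem IsGradedIso.exists_isDGA {Φ : C.Total ≃ₗ[MvPolynomial σ k] C'.Total} (hΦ : IsGradedIso Φ)
    {mul : C'.Total →ₗ[MvPolynomial σ k] C'.Total →ₗ[MvPolynomial σ k] C'.Total}
    (hm : C'.IsDGA mul) (hg : C'.RespectsGrading mul) :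
    ∃ mul : C.Total →ₗ[MvPolynomial σ k] C.Total →ₗ[MvPolynomial σ k] C.Total,
      C.IsDGA mul ∧ C.RespectsGrading mul := by
  let mul' : C.Total →ₗ[MvPolynomial σ k] C.Total →ₗ[MvPolynomial σ k] C.Total :=
    (mul.compl₁₂ Φ.toLinearMap Φ.toLinearMap).compr₂ Φ.symm.toLinearMap
  have hmul : ∀ a b, mul' a b = Φ.symm (mul (Φ a) (Φ b)) := fun a b => rfl
  have hd : ∀ f, C.d (Φ.symm f) = Φ.symm (C'.d f) := fun f => by
    rw [LinearEquiv.eq_symm_apply, ← hΦ.d_comm, LinearEquiv.apply_symm_apply]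
  refine ⟨mul', ⟨?_, ?_, ?_, ?_, ?_⟩, ?_⟩
  · intro p q
    rw [hmul, hΦ.map_one, hΦ.map_one, hm.extends_mul, ← hΦ.map_one, LinearEquiv.symm_apply_apply]
  · intro i a ha b
    rw [hmul, hmul, hmul, hd, hm.leibniz i _ (hΦ.map_hpart i a ha), map_add, map_smul, hΦ.d_comm,
      hΦ.d_comm]
  · intro i j a ha b hb
    exact hΦ.symm_hpart _ _ (hm.mul_hpart i j _ (hΦ.map_hpart i a ha) _ (hΦ.map_hpart j b hb))
  · intro i j a ha b hb
    rw [hmul, hmul, hm.graded_comm i j _ (hΦ.map_hpart i a ha) _ (hΦ.map_hpart j b hb), map_smul]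
  · intro a b c
    simp only [hmul, LinearEquiv.apply_symm_apply, hm.assoc]
  · intro a b m n ha hb
    exact hΦ.symm_degree _ _ (hg _ _ m n (hΦ.degree a m ha) (hΦ.degree b n hb))

/-- The generator of `F_0` is a unit for every DGA structure on a minimal free resolution. -/
theorem IsDGA.one_mul (hC : C.IsMinimalFreeResolution I)
    {mul : C.Total →ₗ[MvPolynomial σ k] C.Total →ₗ[MvPolynomial σ k] C.Total}
    (hm : C.IsDGA mul) {i : ℕ} {f : C.Total} (hf : f ∈ C.hpart i) :
    mul (C.gen C.one) f = f := by
  have h0 : C.gen C.one ∈ C.hpart 0 :=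
    Finsupp.single_mem_supported _ _ ((hC.hdeg_eq_zero_iff _).2 rfl)
  let N : C.Total →ₗ[MvPolynomial σ k] C.Total := LinearMap.id - mul (C.gen C.one)
  have hN : ∀ f, N f = f - mul (C.gen C.one) f := fun f => rfl
  have hone : mul (C.gen C.one) (C.gen C.one) = C.gen C.one := by
    rw [hm.extends_mul, _root_.one_mul]
  have hNN : ∀ f, N (N f) = N f := fun f => by
    simp only [hN, map_sub, ← hm.assoc, hone]
    abel
  have hNd : ∀ f, C.d (N f) = N (C.d f) := fun f => by
    rw [hN, map_sub, hm.leibniz 0 _ h0, hC.d_hpart_zero _ h0, hN]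
    simp
  have hNm : ∀ i, ∀ f ∈ C.hpart i, N f ∈ C.hpart i := fun i f hf =>
    Submodule.sub_mem _ hf (by simpa using hm.mul_hpart 0 i _ h0 f hf)
  -- `N` is an idempotent chain map that vanishes on `F_0`. If it vanishes on `F_i`, it sends
  -- `F_{i+1}` to cycles, which are boundaries and have coordinates in 𝔪.
  have key : ∀ i, ∀ f ∈ C.hpart i, N f = 0 := by
    intro i
    induction i with
    | zero =>
      intro f hf
      rw [hC.mem_hpart_zero_iff.1 hf, hN, hm.extends_mul, _root_.one_mul, sub_self]
    | succ i ih =>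
      intro f hf
      refine eq_zero_of_idempotent_of_mem (hNm (i + 1)) (fun f _ => hNN f) (fun f hf b => ?_) hf
      obtain ⟨t, -, ht⟩ := (hC.exact i _ (hNm _ f hf)).1
        (by rw [hNd, ih _ (hC.d_hpart_succ i f hf)])
      rw [← ht]
      exact hC.minimal t b
  exact (sub_eq_zero.1 (key i f hf)).symm

theorem IsDGA.mul_one (hC : C.IsMinimalFreeResolution I)
    {mul : C.Total →ₗ[MvPolynomial σ k] C.Total →ₗ[MvPolynomial σ k] C.Total}
    (hm : C.IsDGA mul) {i : ℕ} {f : C.Total} (hf : f ∈ C.hpart i) :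
    mul f (C.gen C.one) = f := by
  have h0 : C.gen C.one ∈ C.hpart 0 :=
    Finsupp.single_mem_supported _ _ ((hC.hdeg_eq_zero_iff _).2 rfl)
  rw [hm.graded_comm i 0 f hf _ h0, hm.one_mul hC hf]
  simp

end GradedFreeComplex

/-! ### The algebraic Scarf complex by multidegree, and its cone homotopy. -/

section Scarf

variable {σ k : Type*} [Field k]

theorem lcmExp_mono {V W : Finset (σ →₀ ℕ)} (h : V ⊆ W) : lcmExp V ≤ lcmExp W :=
  Finset.sup_mono h

theorem le_lcmExp {W : Finset (σ →₀ ℕ)} {m : σ →₀ ℕ} (h : m ∈ W) : m ≤ lcmExp W :=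
  Finset.le_sup (f := id) h

open Classical in
/-- The sign of `g_{W \ m}` in the differential of `g_W`. -/
noncomputable def scarfSign (k : Type*) [Field k] (lt : (σ →₀ ℕ) → (σ →₀ ℕ) → Prop)
    (m : σ →₀ ℕ) (W : Finset (σ →₀ ℕ)) : k :=
  (-1) ^ (W.filter fun m' => lt m' m).card

section Sign

variable {lt : (σ →₀ ℕ) → (σ →₀ ℕ) → Prop} {m m' : σ →₀ ℕ} {W : Finset (σ →₀ ℕ)}

theorem scarfSign_mul_self : scarfSign k lt m W * scarfSign k lt m W = 1 := by
  rw [scarfSign, ← mul_pow]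
  simp

open Classical in
theorem scarfSign_erase_of_lt (hm : m ∈ W) (h : lt m m') :
    scarfSign k lt m' (W.erase m) = -scarfSign k lt m' W := by
  have h1 : m ∈ W.filter fun a => lt a m' := Finset.mem_filter.2 ⟨hm, h⟩
  rw [scarfSign, scarfSign, Finset.filter_erase, ← Finset.card_erase_add_one h1, pow_succ]
  simp

open Classical in
theorem scarfSign_erase_of_not_lt (h : ¬ lt m m') :
    scarfSign k lt m' (W.erase m) = scarfSign k lt m' W := by
  rw [scarfSign, scarfSign, Finset.filter_erase, Finset.erase_eq_of_notMem]
  simp [h]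

variable [IsStrictTotalOrder _ lt]

open Classical in
theorem scarfSign_erase_self : scarfSign k lt m (W.erase m) = scarfSign k lt m W :=
  scarfSign_erase_of_not_lt (irrefl_of lt m)

open Classical in
theorem scarfSign_insert_self : scarfSign k lt m (insert m W) = scarfSign k lt m W := by
  by_cases h : m ∈ W
  · rw [Finset.insert_eq_of_mem h]
  · conv_rhs => rw [← Finset.erase_insert h]
    rw [scarfSign_erase_self]

open Classical in
-- Removing the smaller of the two elements flips the sign of the larger; removing the larger leaves
-- the sign of the smaller alone.
theorem scarfSign_swap (hm : m ∈ W) (hm' : m' ∈ W) (hne : m ≠ m') :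
    scarfSign k lt m W * scarfSign k lt m' (W.erase m) =
      -(scarfSign k lt m' W * scarfSign k lt m (W.erase m')) := by
  rcases trichotomous_of lt m m' with h | h | h
  · rw [scarfSign_erase_of_lt hm h, scarfSign_erase_of_not_lt (asymm_of lt h)]
    ring
  · exact absurd h hne
  · rw [scarfSign_erase_of_lt hm' h, scarfSign_erase_of_not_lt (asymm_of lt h)]
    ring

end Sign

variable (lt : (σ →₀ ℕ) → (σ →₀ ℕ) → Prop) {I : Ideal (MvPolynomial σ k)} (hI : I ≠ ⊤)

/-- The basis index of the algebraic Scarf complex given by the face `W`. -/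
noncomputable def scarfIndex (W : Finset (σ →₀ ℕ)) (h : IsScarfFace I W) :
    (algebraicScarfComplex lt I hI).B :=
  (⟨W, h⟩ : {W // IsScarfFace I W})

/-- The face given by a basis index of the algebraic Scarf complex. -/
noncomputable def scarfSet {lt : (σ →₀ ℕ) → (σ →₀ ℕ) → Prop} {hI : I ≠ ⊤}
    (x : (algebraicScarfComplex lt I hI).B) : Finset (σ →₀ ℕ) :=
  (show {W // IsScarfFace I W} from x).1

theorem isScarfFace_scarfSet {lt : (σ →₀ ℕ) → (σ →₀ ℕ) → Prop} {hI : I ≠ ⊤}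
    (x : (algebraicScarfComplex lt I hI).B) : IsScarfFace I (scarfSet x) :=
  (show {W // IsScarfFace I W} from x).2

theorem scarfIndex_scarfSet (x : (algebraicScarfComplex lt I hI).B) :
    scarfIndex lt hI (scarfSet x) (isScarfFace_scarfSet x) = x := rfl

theorem scarfSet_scarfIndex (W : Finset (σ →₀ ℕ)) (h : IsScarfFace I W) :
    scarfSet (scarfIndex lt hI W h) = W := rfl

open Classical in
/-- The element of multidegree `u` of the summand of the algebraic Scarf complex with basis `g_W`;
it is zero when `W` is not a face. -/
noncomputable def scarfTerm (u : σ →₀ ℕ) (W : Finset (σ →₀ ℕ)) :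
    (algebraicScarfComplex lt I hI).Total :=
  if h : IsScarfFace I W then
    Finsupp.single (scarfIndex lt hI W h) (monomial (u - lcmExp W) 1) else 0

theorem scarfTerm_of_face {W : Finset (σ →₀ ℕ)} (h : IsScarfFace I W) (u : σ →₀ ℕ) :
    scarfTerm lt hI u W =
      Finsupp.single (scarfIndex lt hI W h) (monomial (u - lcmExp W) 1) := by
  rw [scarfTerm, dif_pos h]

theorem scarfTerm_mem_hpart (u : σ →₀ ℕ) (W : Finset (σ →₀ ℕ)) :
    scarfTerm lt hI u W ∈ (algebraicScarfComplex lt I hI).hpart W.card := by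
  rw [scarfTerm]
  split_ifs with h
  · exact Finsupp.single_mem_supported _ _ rfl
  · exact zero_mem _

theorem single_monomial_eq_smul_scarfTerm {W : Finset (σ →₀ ℕ)} (h : IsScarfFace I W)
    (c : σ →₀ ℕ) (a : k) :
    (Finsupp.single (scarfIndex lt hI W h) (monomial c a) :
      (algebraicScarfComplex lt I hI).Total) = a • scarfTerm lt hI (c + lcmExp W) W := by
  rw [scarfTerm_of_face lt hI h, add_tsub_cancel_right, Finsupp.smul_single, smul_monomial,
    smul_eq_mul, mul_one]

open Classical in
theorem scarf_d_single {W : Finset (σ →₀ ℕ)} (h : IsScarfFace I W) (p : MvPolynomial σ k) :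
    (algebraicScarfComplex lt I hI).d (Finsupp.single (scarfIndex lt hI W h) p) =
      p • ∑ m ∈ W, Finsupp.single (scarfIndex lt hI (W.erase m) (h.erase m))
        (C (scarfSign k lt m W) * monomial (lcmExp W - lcmExp (W.erase m)) (1 : k)) := by
  have hd : (algebraicScarfComplex lt I hI).d =
      Finsupp.linearCombination (MvPolynomial σ k) fun x => ∑ m ∈ scarfSet x,
        Finsupp.single
          (scarfIndex lt hI ((scarfSet x).erase m) ((isScarfFace_scarfSet x).erase m))
          ((-1) ^ ((scarfSet x).filter fun m' => lt m' m).card *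
            monomial (lcmExp (scarfSet x) - lcmExp ((scarfSet x).erase m)) (1 : k)) := rfl
  rw [hd, Finsupp.linearCombination_single]
  simp only [scarfSign, map_pow, map_neg, map_one, scarfSet_scarfIndex]

open Classical in
-- In a fixed multidegree `u` the monomial coefficients are absorbed and the differential becomes
-- the simplicial boundary over `k`.
theorem scarf_d_scarfTerm {u : σ →₀ ℕ} {W : Finset (σ →₀ ℕ)} (h : IsScarfFace I W)
    (hu : lcmExp W ≤ u) :
    (algebraicScarfComplex lt I hI).d (scarfTerm lt hI u W) =
      ∑ m ∈ W, scarfSign k lt m W • scarfTerm lt hI u (W.erase m) := by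
  rw [scarfTerm_of_face lt hI h, scarf_d_single, Finset.smul_sum]
  refine Finset.sum_congr rfl fun m _ => ?_
  rw [scarfTerm_of_face lt hI (h.erase m), Finsupp.smul_single, Finsupp.smul_single, smul_eq_mul,
    mul_left_comm, monomial_mul, mul_one, ← smul_eq_C_mul,
    tsub_add_tsub_cancel hu (lcmExp_mono (W.erase_subset m))]

/-- Reduces claims to monomial multiples of basis elements. Only monomials occurring in `f` are
tested, so restrictions on the homological degree or multidegree of `f` can be used. -/
theorem scarf_ext {M : Type*} [AddCommGroup M] [Module k M]
    {f : (algebraicScarfComplex lt I hI).Total} (φ : (algebraicScarfComplex lt I hI).Total →ₗ[k] M)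
    (h : ∀ (W : Finset (σ →₀ ℕ)) (hW : IsScarfFace I W) (c : σ →₀ ℕ),
      coeff c (f (scarfIndex lt hI W hW)) ≠ 0 → φ (scarfTerm lt hI (c + lcmExp W) W) = 0) : φ f = 0 := by
  rw [← Finsupp.sum_single f, Finsupp.sum, map_sum]
  refine Finset.sum_eq_zero fun W _ => ?_
  rw [← scarfIndex_scarfSet lt hI W, (f _).as_sum, ← Finsupp.singleAddHom_apply, map_sum, map_sum]
  refine Finset.sum_eq_zero fun c hc => ?_
  rw [Finsupp.singleAddHom_apply, single_monomial_eq_smul_scarfTerm, map_smul,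
    h _ _ c (mem_support_iff.1 hc), smul_zero]

open Classical in
/-- The contracting homotopy that joins each face of multidegree at most `u` with `v u`. -/
noncomputable def scarfHomotopy (v : (σ →₀ ℕ) → (σ →₀ ℕ)) :
    (algebraicScarfComplex lt I hI).Total →ₗ[k] (algebraicScarfComplex lt I hI).Total :=
  -- The multidegree of the monomial `c` times g_W is `c + lcmExp W`. The apex depends on it, so the
  -- map is only `k`-linear.
  Finsupp.lsum k fun W => (basisMonomials σ k).constr k fun c =>
    if v (c + lcmExp (scarfSet W)) ∈ scarfSet W then 0 else
      scarfSign k lt (v (c + lcmExp (scarfSet W))) (scarfSet W) •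
        scarfTerm lt hI (c + lcmExp (scarfSet W)) (insert (v (c + lcmExp (scarfSet W))) (scarfSet W))

open Classical in
theorem scarfHomotopy_scarfTerm (v : (σ →₀ ℕ) → (σ →₀ ℕ)) {u : σ →₀ ℕ}
    {W : Finset (σ →₀ ℕ)} (h : IsScarfFace I W) (hu : lcmExp W ≤ u) :
    scarfHomotopy lt hI v (scarfTerm lt hI u W) = if v u ∈ W then 0 else
      scarfSign k lt (v u) W • scarfTerm lt hI u (insert (v u) W) := by
  have h1 : (monomial (u - lcmExp W) (1 : k)) = basisMonomials σ k (u - lcmExp W) := by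
    rw [coe_basisMonomials]
  rw [scarfTerm_of_face lt hI h, scarfHomotopy, Finsupp.lsum_single, h1, Module.Basis.constr_basis]
  simp only [scarfSet_scarfIndex, tsub_add_cancel_of_le hu]

theorem scarfHomotopy_mem_hpart (v : (σ →₀ ℕ) → (σ →₀ ℕ)) {i : ℕ}
    {f : (algebraicScarfComplex lt I hI).Total} (hf : f ∈ (algebraicScarfComplex lt I hI).hpart i) :
    scarfHomotopy lt hI v f ∈ (algebraicScarfComplex lt I hI).hpart (i + 1) := by
  classical
  -- Passing to the quotient by `P` turns membership into the vanishing of a `k`-linear map, as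
  -- `scarf_ext` requires.
  let P := (algebraicScarfComplex lt I hI).hpart (i + 1)
  rw [← Submodule.Quotient.mk_eq_zero]
  refine scarf_ext lt hI ((P.mkQ.restrictScalars k) ∘ₗ scarfHomotopy lt hI v) (f := f)
    fun W hW c hc => ?_
  have hi : W.card = i := hf (Finsupp.mem_support_iff.2 fun h => hc (by rw [h, coeff_zero]))
  change P.mkQ _ = 0
  rw [Submodule.mkQ_apply, Submodule.Quotient.mk_eq_zero, scarfHomotopy_scarfTerm lt hI v hW
    le_add_self]
  split_ifs with h
  · exact zero_mem _
  · refine Submodule.smul_of_tower_mem _ _ ?_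
    have := scarfTerm_mem_hpart lt hI (c + lcmExp W) (insert (v (c + lcmExp W)) W)
    rwa [Finset.card_insert_of_notMem h, hi] at this

variable [IsStrictTotalOrder _ lt]

open Classical in
theorem scarf_d_d (f : (algebraicScarfComplex lt I hI).Total) :
    (algebraicScarfComplex lt I hI).d ((algebraicScarfComplex lt I hI).d f) = 0 := by
  let D := (algebraicScarfComplex lt I hI).d.restrictScalars k
  refine scarf_ext lt hI (D ∘ₗ D) (f := f) fun W hW c _ => ?_
  set u := c + lcmExp W
  have hu : lcmExp W ≤ u := le_add_self
  change (algebraicScarfComplex lt I hI).d ((algebraicScarfComplex lt I hI).d _) = 0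
  rw [scarf_d_scarfTerm lt hI hW hu, map_sum]
  have : ∀ m ∈ W, (algebraicScarfComplex lt I hI).d
      (scarfSign k lt m W • scarfTerm lt hI u (W.erase m)) =
      ∑ m' ∈ W.erase m, (scarfSign k lt m W * scarfSign k lt m' (W.erase m)) •
        scarfTerm lt hI u ((W.erase m).erase m') := fun m _ => by
    rw [LinearMap.map_smul_of_tower, scarf_d_scarfTerm lt hI (hW.erase m)
      ((lcmExp_mono (W.erase_subset m)).trans hu), Finset.smul_sum]
    simp only [smul_smul]
  rw [Finset.sum_congr rfl this, Finset.sum_sigma']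
  -- Removing `m` and then `m'` cancels against removing them in the other order.
  refine Finset.sum_involution (fun x _ => ⟨x.2, x.1⟩) ?_ ?_ ?_ ?_
  · rintro ⟨m, m'⟩ h
    simp only [Finset.mem_sigma, Finset.mem_erase] at h
    simp only
    rw [scarfSign_swap h.1 h.2.2 h.2.1.symm, Finset.erase_right_comm, neg_smul, neg_add_cancel]
  · rintro ⟨m, m'⟩ h _ he
    simp only [Finset.mem_sigma, Finset.mem_erase] at h
    simp only [Sigma.mk.injEq] at he
    exact h.2.1 he.1
  · rintro ⟨m, m'⟩ h
    simp only [Finset.mem_sigma, Finset.mem_erase] at h ⊢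
    exact ⟨h.2.2, h.2.1.symm, h.1⟩
  · rintro ⟨m, m'⟩ h
    rfl

open Classical in
theorem scarf_homotopy_identity {v : (σ →₀ ℕ) → (σ →₀ ℕ)} {u : σ →₀ ℕ} {W : Finset (σ →₀ ℕ)}
    (h : IsScarfFace I W) (hu : lcmExp W ≤ u) (hv : v u ≤ u)
    (hcone : IsScarfFace I (insert (v u) W)) :
    (algebraicScarfComplex lt I hI).d (scarfHomotopy lt hI v (scarfTerm lt hI u W)) +
      scarfHomotopy lt hI v ((algebraicScarfComplex lt I hI).d (scarfTerm lt hI u W)) =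
    scarfTerm lt hI u W := by
  have he : ∀ m, lcmExp (W.erase m) ≤ u := fun m =>
    (lcmExp_mono (W.erase_subset m)).trans hu
  rw [scarf_d_scarfTerm lt hI h hu, map_sum]
  simp only [map_smul]
  rw [scarfHomotopy_scarfTerm lt hI v h hu,
    Finset.sum_congr rfl fun m _ => by rw [scarfHomotopy_scarfTerm lt hI v (h.erase m) (he m)]]
  by_cases hvW : v u ∈ W
  · rw [if_pos hvW, map_zero, zero_add, Finset.sum_eq_single (v u)]
    · rw [if_neg (Finset.notMem_erase _ _), smul_smul, scarfSign_erase_self, scarfSign_mul_self,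
        one_smul, Finset.insert_erase hvW]
    · intro m _ hm
      rw [if_pos (Finset.mem_erase.2 ⟨hm.symm, hvW⟩), smul_zero]
    · exact fun h => absurd hvW h
  · have hle : lcmExp (insert (v u) W) ≤ u := by
      rw [lcmExp, Finset.sup_insert]
      exact sup_le hv hu
    -- Otherwise removing the apex from the join returns `W`, and the remaining terms cancel in
    -- pairs by `scarfSign_swap`.
    rw [if_neg hvW, LinearMap.map_smul_of_tower, scarf_d_scarfTerm lt hI hcone hle,
      Finset.sum_insert hvW, Finset.erase_insert hvW, smul_add, smul_smul, scarfSign_insert_self,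
      scarfSign_mul_self, one_smul, add_assoc, Finset.smul_sum, ← Finset.sum_add_distrib,
      Finset.sum_eq_zero, add_zero]
    intro m hm
    have hne : v u ≠ m := fun h => hvW (h ▸ hm)
    rw [if_neg fun h => hvW (Finset.mem_of_mem_erase h), smul_smul, smul_smul,
      Finset.erase_insert_of_ne hne, ← add_smul]
    have hs := scarfSign_swap (k := k) (lt := lt) (Finset.mem_insert_self (v u) W)
      (Finset.mem_insert_of_mem hm) hne
    rw [Finset.erase_insert hvW, Finset.erase_insert_of_ne hne, scarfSign_insert_self,
      scarfSign_insert_self] at hs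
    have h1 := scarfSign_mul_self (k := k) (lt := lt) (m := m) (W := W)
    have h2 := scarfSign_mul_self (k := k) (lt := lt) (m := m) (W := insert (v u) W)
    have hzero : scarfSign k lt (v u) W * scarfSign k lt m (insert (v u) W) +
        scarfSign k lt m W * scarfSign k lt (v u) (W.erase m) = 0 := by
      linear_combination (scarfSign k lt m W * scarfSign k lt m (insert (v u) W)) * hs -
        (scarfSign k lt (v u) W * scarfSign k lt m (insert (v u) W)) * h1 -
        (scarfSign k lt m W * scarfSign k lt (v u) (W.erase m)) * h2
    rw [hzero, zero_smul]

end Scarf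

/-! ### The cone criterion for the algebraic Scarf complex to be a resolution. -/

section ScarfResolution

variable {σ k : Type*} [Field k] {I : Ideal (MvPolynomial σ k)}

theorem IsMonomialIdeal.monomial_mem (h : IsMonomialIdeal I) {p : MvPolynomial σ k} (hp : p ∈ I)
    {c : σ →₀ ℕ} (hc : coeff c p ≠ 0) : monomial c (1 : k) ∈ I := by
  obtain ⟨A, rfl⟩ := h
  obtain ⟨a, ha, hac⟩ := mem_ideal_span_monomial_image.1 hp c (mem_support_iff.2 hc)
  refine mem_ideal_span_monomial_image.2 fun x hx => ⟨a, ha, ?_⟩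
  rwa [Finset.mem_singleton.1 (support_monomial_subset hx)]

theorem IsScarfFace.monomial_mem {W : Finset (σ →₀ ℕ)} (h : IsScarfFace I W) (hW : W.Nonempty)
    {u : σ →₀ ℕ} (hu : lcmExp W ≤ u) : monomial u (1 : k) ∈ I := by
  obtain ⟨m, hm⟩ := hW
  have h1 : monomial m (1 : k) ∈ I := (h.1 hm).1
  rw [← tsub_add_cancel_of_le ((le_lcmExp hm).trans hu), ← one_mul (1 : k), ← monomial_mul]
  exact I.mul_mem_left _ h1

open Classical in
/-- If for every monomial `u` of `I` the faces of multidegree at most `u` form a cone, then the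
algebraic Scarf complex is a minimal free resolution. -/
theorem scarf_isMinimalFreeResolution (hI : I ≠ ⊤) (hmon : IsMonomialIdeal I)
    (lt : (σ →₀ ℕ) → (σ →₀ ℕ) → Prop) [IsStrictTotalOrder _ lt]
    (hcone : ∀ u, monomial u (1 : k) ∈ I → ∃ v ≤ u, ∀ W, IsScarfFace I W → lcmExp W ≤ u →
      IsScarfFace I (insert v W)) :
    (algebraicScarfComplex lt I hI).IsMinimalFreeResolution I := by
  have hcone' : ∀ u, ∃ v, monomial u (1 : k) ∈ I → v ≤ u ∧ ∀ W, IsScarfFace I W →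
      lcmExp W ≤ u → IsScarfFace I (insert v W) := fun u => by
    by_cases h : monomial u (1 : k) ∈ I
    · obtain ⟨v, hv⟩ := hcone u h
      exact ⟨v, fun _ => hv⟩
    -- Outside `I` the apex is an arbitrary value; the homotopy identity is used only in
    -- multidegrees of `I`.
    · exact ⟨0, fun h' => absurd h' h⟩
  choose v hv using hcone'
  have hzero : ∀ x : (algebraicScarfComplex lt I hI).B,
      (algebraicScarfComplex lt I hI).hdeg x = 0 ↔ x = (algebraicScarfComplex lt I hI).one :=
    fun x => ⟨fun h => Subtype.ext (Finset.card_eq_zero.1 h), fun h => h ▸ rfl⟩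
  have hhom : ∀ f : (algebraicScarfComplex lt I hI).Total,
      (∀ (W : Finset (σ →₀ ℕ)) (hW : IsScarfFace I W) (c : σ →₀ ℕ),
        coeff c (f (scarfIndex lt hI W hW)) ≠ 0 → monomial (c + lcmExp W) (1 : k) ∈ I) →
      (algebraicScarfComplex lt I hI).d (scarfHomotopy lt hI v f) +
        scarfHomotopy lt hI v ((algebraicScarfComplex lt I hI).d f) = f := by
    intro f hf
    let D := (algebraicScarfComplex lt I hI).d.restrictScalars k
    let H := scarfHomotopy lt hI v
    refine sub_eq_zero.1 (scarf_ext lt hI (D ∘ₗ H + H ∘ₗ D - LinearMap.id) fun W hW c hc => ?_)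
    have hv' := hv _ (hf W hW c hc)
    exact sub_eq_zero.2 (scarf_homotopy_identity lt hI hW le_add_self hv'.1
      (hv'.2 W hW le_add_self))
  -- In positive homological degree a face is nonempty, so its multidegree automatically lies in
  -- `I`.
  have hsucc : ∀ i, ∀ f ∈ (algebraicScarfComplex lt I hI).hpart (i + 1),
      (algebraicScarfComplex lt I hI).d (scarfHomotopy lt hI v f) +
        scarfHomotopy lt hI v ((algebraicScarfComplex lt I hI).d f) = f := by
    intro i f hf
    refine hhom f fun W hW c hc => hW.monomial_mem ?_ le_add_self
    have hi : W.card = i + 1 := hf (Finsupp.mem_support_iff.2 fun h => hc (by rw [h, coeff_zero]))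
    exact Finset.card_pos.1 (by omega)
  have hd : ∀ x, (algebraicScarfComplex lt I hI).d ((algebraicScarfComplex lt I hI).gen x) =
      ∑ m ∈ scarfSet x, Finsupp.single
        (scarfIndex lt hI ((scarfSet x).erase m) ((isScarfFace_scarfSet x).erase m))
        (C (scarfSign k lt m (scarfSet x)) *
          monomial (lcmExp (scarfSet x) - lcmExp ((scarfSet x).erase m)) (1 : k)) := fun x => by
    have := scarf_d_single lt hI (isScarfFace_scarfSet x) 1
    rwa [one_smul] at this
  have hd0 : ∀ f ∈ (algebraicScarfComplex lt I hI).hpart 0,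
      (algebraicScarfComplex lt I hI).d f = 0 := by
    intro f hf
    rw [GradedFreeComplex.map_eq_sum]
    refine Finset.sum_eq_zero fun x hx => ?_
    have : scarfSet x = ∅ := Finset.card_eq_zero.1 (hf hx)
    rw [hd, Finset.sum_eq_zero, smul_zero]
    intro m hm
    rw [this] at hm
    simp at hm
  refine ⟨hzero, ?_, hd0, ?_, ?_, ?_, ?_, ?_⟩
  · change (((∅ : Finset (σ →₀ ℕ)).sup id).degree : ℤ) = 0
    rw [Finset.sup_empty, bot_eq_zero, map_zero, Nat.cast_zero]
  · intro i f hf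
    refine GradedFreeComplex.map_mem_of_gen (fun x hx => ?_) hf
    rw [hd]
    refine Submodule.sum_mem _ fun m hm => Finsupp.single_mem_supported _ _ ?_
    change ((scarfSet x).erase m).card = i
    rw [Finset.card_erase_of_mem hm]
    change (scarfSet x).card = i + 1 at hx
    omega
  · refine GradedFreeComplex.preservesDegree_of_gen fun x => ?_
    rw [hd]
    refine GradedFreeComplex.IsHomogeneousOfDegree.sum fun m _ => ?_
    refine GradedFreeComplex.isHomogeneousOfDegree_single
      ((isWeightedHomogeneous_monomial _ _ _ rfl).C_mul _) ?_
    rw [weight_one_eq_degree]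
    change ((lcmExp (scarfSet x)).degree : ℤ) =
      _ + ((lcmExp ((scarfSet x).erase m)).degree : ℤ)
    rw [← Nat.cast_add, ← map_add, tsub_add_cancel_of_le (lcmExp_mono (Finset.erase_subset _ _))]
  · intro p
    constructor
    · intro hp
      have h0 : Finsupp.single (algebraicScarfComplex lt I hI).one p ∈
          (algebraicScarfComplex lt I hI).hpart 0 :=
        Finsupp.single_mem_supported _ _ ((hzero _).2 rfl)
      refine ⟨scarfHomotopy lt hI v (Finsupp.single (algebraicScarfComplex lt I hI).one p),
        scarfHomotopy_mem_hpart lt hI v h0, ?_⟩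
      -- In homological degree 0 the multidegrees are the monomials of `p`, which lie in `I` because
      -- `I` is a monomial ideal.
      have h := hhom (Finsupp.single (algebraicScarfComplex lt I hI).one p) fun W hW c hc => by
        rw [Finsupp.single_apply] at hc
        split_ifs at hc with hW0
        · have hW0 : W = ∅ := (congrArg scarfSet hW0).symm
          rw [hW0, lcmExp, Finset.sup_empty, bot_eq_zero, add_zero]
          exact hmon.monomial_mem hp hc
        · simp at hc
      rwa [hd0 _ h0, map_zero, add_zero] at h
    · rintro ⟨g, hg, hgp⟩
      have : p = (algebraicScarfComplex lt I hI).d g (algebraicScarfComplex lt I hI).one := by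
        rw [hgp, Finsupp.single_eq_same]
      rw [this, GradedFreeComplex.map_eq_sum, Finsupp.finsetSum_apply]
      refine I.sum_mem fun x hx => I.mul_mem_left _ ?_
      rw [hd, Finsupp.finsetSum_apply]
      refine I.sum_mem fun m hm => ?_
      rw [Finsupp.single_apply]
      split_ifs with hx0
      · have he : (scarfSet x).erase m = ∅ := congrArg scarfSet hx0
        rw [he, lcmExp, lcmExp, Finset.sup_empty, bot_eq_zero, tsub_zero]
        exact I.mul_mem_left _ ((isScarfFace_scarfSet x).monomial_mem ⟨m, hm⟩ le_rfl)
      · exact zero_mem _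
  · intro i f hf
    constructor
    · intro h
      refine ⟨scarfHomotopy lt hI v f, scarfHomotopy_mem_hpart lt hI v hf, ?_⟩
      have := hsucc i f hf
      rwa [h, map_zero, add_zero] at this
    · rintro ⟨g, -, rfl⟩
      exact scarf_d_d lt hI g
  · intro f y
    rw [GradedFreeComplex.map_eq_sum, Finsupp.finsetSum_apply]
    refine Ideal.sum_mem _ fun x _ => Ideal.mul_mem_left _ _ ?_
    rw [hd, Finsupp.finsetSum_apply]
    refine Ideal.sum_mem _ fun m hm => ?_
    rw [Finsupp.single_apply]
    split_ifs
    -- A constant coefficient would mean that `W` and `W.erase m` have the same lcm, contrary to the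
    -- Scarf condition.
    · rw [mem_span_range_X_iff, coeff_C_mul, coeff_monomial, if_neg, mul_zero]
      intro h0
      have hle := tsub_eq_zero_iff_le.1 h0
      have heq : lcmExp ((scarfSet x).erase m) = lcmExp (scarfSet x) :=
        le_antisymm (lcmExp_mono (Finset.erase_subset _ _)) hle
      have := (isScarfFace_scarfSet x).2 _ ((isScarfFace_scarfSet x).erase m).1 heq
      exact Finset.erase_eq_self.1 this hm
    · exact zero_mem _

end ScarfResolution

/-! ### Minimal generators of an ideal spanned by an antichain of monomials. -/

section MinimalGenerators

variable {σ k : Type*} [Field k]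

theorem monomial_mem_span_iff {A : Set (σ →₀ ℕ)} {u : σ →₀ ℕ} :
    monomial u (1 : k) ∈ Ideal.span ((fun a => monomial a (1 : k)) '' A) ↔ ∃ a ∈ A, a ≤ u := by
  classical
  rw [mem_ideal_span_monomial_image, support_monomial, if_neg one_ne_zero]
  simp

theorem minimalGenerators_span {A : Set (σ →₀ ℕ)} (hA : IsAntichain (· ≤ ·) A) :
    minimalGenerators (Ideal.span ((fun a => monomial a (1 : k)) '' A)) = A := by
  ext m
  simp only [minimalGenerators, monomial_mem_span_iff, Set.mem_ofPred_eq]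
  constructor
  · rintro ⟨⟨a, ha, ham⟩, hmin⟩
    rwa [le_antisymm (hmin ⟨a, ha, le_rfl⟩ ham) ham]
  · refine fun hm => ⟨⟨m, hm, le_rfl⟩, ?_⟩
    rintro b ⟨a, ha, hab⟩ hbm
    rwa [hA.eq ha hm (hab.trans hbm)] at hab

end MinimalGenerators

/-! ### The ideal ⟨x², xy, y²z², zw, w²⟩ and its Scarf complex. -/

/-- The exponents of `x², xy, y²z², zw, w²`. -/
def katExp : Fin 5 → Fin 4 → ℕ :=
  ![![2, 0, 0, 0], ![1, 1, 0, 0], ![0, 2, 2, 0], ![0, 0, 1, 1], ![0, 0, 0, 2]]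

/-- The exponent vectors of `x², xy, y²z², zw, w²`. -/
noncomputable def katGen : Fin 5 ↪ (Fin 4 →₀ ℕ) :=
  ⟨fun i => Finsupp.equivFunOnFinite.symm (katExp i),
    Finsupp.equivFunOnFinite.symm.injective.comp (by decide)⟩

theorem katGen_apply (i : Fin 5) (j : Fin 4) : katGen i j = katExp i j := rfl

theorem katGen_le_iff {i : Fin 5} {u : Fin 4 →₀ ℕ} : katGen i ≤ u ↔ ∀ j, katExp i j ≤ u j :=
  Iff.rfl

/-- Moves lcms from finitely supported functions to plain functions on `Fin 4`, where `decide` can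
evaluate them. -/
theorem lcmExp_map_katGen (s : Finset (Fin 5)) :
    lcmExp (s.map katGen) = Finsupp.equivFunOnFinite.symm (s.sup katExp) := by
  induction s using Finset.cons_induction with
  | empty =>
    rw [lcmExp, Finset.map_empty, Finset.sup_empty, Finset.sup_empty]
    ext j
    rfl
  | cons i s hi ih =>
    rw [lcmExp] at ih ⊢
    rw [Finset.map_cons, Finset.sup_cons, ih, Finset.sup_cons]
    ext j
    rfl

/-- The faces of the Scarf complex: a tetrahedron and a triangle sharing an edge. -/
def KatFace (s : Finset (Fin 5)) : Prop := 2 ∈ s → 0 ∉ s ∧ 4 ∉ s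

instance : DecidablePred KatFace := fun s => inferInstanceAs (Decidable (2 ∈ s → 0 ∉ s ∧ 4 ∉ s))

set_option maxRecDepth 100000 in
-- The excluded edges come from xy dividing lcm(x², y²z²) and zw dividing lcm(y²z², w²).
theorem katFace_iff_sup (s : Finset (Fin 5)) :
    KatFace s ↔ ∀ t : Finset (Fin 5), t.sup katExp = s.sup katExp → t = s := by
  revert s
  decide

theorem X_pow_eq_monomial_katGen (k : Type*) [Field k] :
    ({X 0 ^ 2, X 0 * X 1, X 1 ^ 2 * X 2 ^ 2, X 2 * X 3, X 3 ^ 2} : Set (MvPolynomial (Fin 4) k)) =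
      (fun a => monomial a (1 : k)) '' Set.range katGen := by
  have h : ∀ i, monomial (katGen i) (1 : k) = X 0 ^ katExp i 0 * X 1 ^ katExp i 1 *
      X 2 ^ katExp i 2 * X 3 ^ katExp i 3 := fun i => by
    rw [monomial_eq, map_one, one_mul, Finsupp.prod_fintype _ _ fun i => pow_zero _,
      Fin.prod_univ_four]
    rfl
  rw [← Set.range_comp]
  ext p
  simp only [Set.mem_insert_iff, Set.mem_singleton_iff, Set.mem_range, Function.comp_apply, h,
    Fin.exists_fin_succ, katExp]
  simp [eq_comm]

section KatthanIdeal

variable {k : Type v} [Field k] {I : Ideal (MvPolynomial (Fin 4) k)}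

theorem katGen_antichain : IsAntichain (· ≤ ·) (Set.range katGen) := by
  rintro _ ⟨i, rfl⟩ _ ⟨j, rfl⟩ hne hle
  refine hne (congrArg katGen ?_)
  rw [katGen_le_iff] at hle
  clear hne
  simp only [katGen_apply] at hle
  revert i j
  decide

variable (hI : I = Ideal.span {X 0 ^ 2, X 0 * X 1, X 1 ^ 2 * X 2 ^ 2, X 2 * X 3, X 3 ^ 2})

include hI

theorem katIdeal_eq : I = Ideal.span ((fun a => monomial a (1 : k)) '' Set.range katGen) := by
  rw [hI, X_pow_eq_monomial_katGen]

theorem katIdeal_minimalGenerators : minimalGenerators I = Set.range katGen := by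
  rw [katIdeal_eq hI, minimalGenerators_span katGen_antichain]

theorem katIdeal_isMonomialIdeal : IsMonomialIdeal I := ⟨_, katIdeal_eq hI⟩

theorem katIdeal_monomial_mem_iff {u : Fin 4 →₀ ℕ} :
    monomial u (1 : k) ∈ I ↔ ∃ i, katGen i ≤ u := by
  rw [katIdeal_eq hI, monomial_mem_span_iff, Set.exists_range_iff]

theorem katIdeal_ne_top : I ≠ ⊤ := by
  intro h
  have h1 : monomial 0 (1 : k) ∈ I := by rw [h]; trivial
  obtain ⟨i, hi⟩ := (katIdeal_monomial_mem_iff hI).1 h1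
  rw [katGen_le_iff] at hi
  simp only [Finsupp.coe_zero, Pi.zero_apply] at hi
  revert i
  decide

theorem katIdeal_isStronglyGeneric : IsStronglyGeneric I := by
  refine ⟨katIdeal_isMonomialIdeal hI, ?_⟩
  rw [katIdeal_minimalGenerators hI]
  rintro _ ⟨i, rfl⟩ _ ⟨j, rfl⟩ hne l
  have hij : i ≠ j := fun h => hne (congrArg katGen h)
  clear hne
  rw [katGen_apply, katGen_apply]
  revert i j l
  decide

theorem exists_map_katGen {W : Finset (Fin 4 →₀ ℕ)}
    (hW : (W : Set (Fin 4 →₀ ℕ)) ⊆ minimalGenerators I) : ∃ s : Finset (Fin 5), W = s.map katGen := by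
  classical
  rw [katIdeal_minimalGenerators hI] at hW
  obtain ⟨s, -, rfl⟩ := (Finset.subset_set_image_iff (s := Set.univ) (f := katGen)).1
    (by rwa [Set.image_univ])
  exact ⟨s, (Finset.map_eq_image _ _).symm⟩

theorem isScarfFace_map_katGen_iff {s : Finset (Fin 5)} :
    IsScarfFace I (s.map katGen) ↔ KatFace s := by
  have hsub : ∀ t : Finset (Fin 5),
      ((t.map katGen : Finset (Fin 4 →₀ ℕ)) : Set (Fin 4 →₀ ℕ)) ⊆ minimalGenerators I := fun t => by
    rw [katIdeal_minimalGenerators hI, Finset.coe_map]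
    exact Set.image_subset_range _ _
  rw [katFace_iff_sup]
  constructor
  · intro h t ht
    exact Finset.map_injective katGen
      (h.2 _ (hsub t) (by rw [lcmExp_map_katGen, lcmExp_map_katGen, ht]))
  · refine fun h => ⟨hsub s, fun V hV hVs => ?_⟩
    obtain ⟨t, rfl⟩ := exists_map_katGen hI hV
    rw [lcmExp_map_katGen, lcmExp_map_katGen, EmbeddingLike.apply_eq_iff_eq] at hVs
    rw [h t hVs]

theorem katIdeal_scarf_isMinimalFreeResolution (hI' : I ≠ ⊤)
    (lt : (Fin 4 →₀ ℕ) → (Fin 4 →₀ ℕ) → Prop) [IsStrictTotalOrder _ lt] :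
    (algebraicScarfComplex lt I hI').IsMinimalFreeResolution I := by
  classical
  refine scarf_isMinimalFreeResolution hI' (katIdeal_isMonomialIdeal hI) lt fun u hu => ?_
  suffices h : ∃ i, katGen i ≤ u ∧
      ∀ s : Finset (Fin 5), KatFace s → (∀ j ∈ s, katGen j ≤ u) → KatFace (insert i s) by
    obtain ⟨i, hi, hs⟩ := h
    refine ⟨katGen i, hi, fun W hW hWu => ?_⟩
    obtain ⟨s, rfl⟩ := exists_map_katGen hI hW.1
    have := hs s ((isScarfFace_map_katGen_iff hI).1 hW)
      fun j hj => (le_lcmExp (Finset.mem_map_of_mem _ hj)).trans hWu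
    rw [← isScarfFace_map_katGen_iff hI, Finset.map_insert] at this
    convert this
  have hle : ∀ i, katGen i ≤ u ↔ katExp i 0 ≤ u 0 ∧ katExp i 1 ≤ u 1 ∧ katExp i 2 ≤ u 2 ∧
      katExp i 3 ≤ u 3 := fun i => by
    rw [katGen_le_iff, Fin.forall_fin_succ, Fin.forall_fin_succ, Fin.forall_fin_succ,
      Fin.forall_fin_succ]
    simp
  -- The faces fail to include a set only when c meets a or e, and in those cases b or d also
  -- divides `u` and can serve as apex.
  have h02 : katGen 0 ≤ u → katGen 2 ≤ u → katGen 1 ≤ u := by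
    simp only [hle, katExp]
    simp
    omega
  have h24 : katGen 2 ≤ u → katGen 4 ≤ u → katGen 3 ≤ u := by
    simp only [hle, katExp]
    simp
    omega
  simp only [KatFace, Finset.mem_insert]
  -- Inserting b or d never affects `KatFace`, so either is an apex. If neither divides `u`, then c
  -- cannot occur together with a or e, and any available generator is an apex.
  by_cases h1 : katGen 1 ≤ u
  · exact ⟨1, h1, fun s hs _ => by simpa using hs⟩
  by_cases h3 : katGen 3 ≤ u
  · exact ⟨3, h3, fun s hs _ => by simpa using hs⟩
  by_cases h0 : katGen 0 ≤ u
  · refine ⟨0, h0, fun s hs hu h2 => ?_⟩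
    exact absurd (h02 h0 (hu 2 (by simpa using h2))) h1
  by_cases h4 : katGen 4 ≤ u
  · refine ⟨4, h4, fun s hs hu h2 => ?_⟩
    exact absurd (h24 (hu 2 (by simpa using h2)) h4) h3
  by_cases h2 : katGen 2 ≤ u
  · refine ⟨2, h2, fun s hs hu _ => ?_⟩
    have h0' : 0 ∉ s := fun h => h0 (hu 0 h)
    have h4' : 4 ∉ s := fun h => h4 (hu 4 h)
    simp [h0', h4']
  obtain ⟨i, hi⟩ := (katIdeal_monomial_mem_iff hI).1 hu
  fin_cases i <;> contradiction

end KatthanIdeal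

/-- The difference is a homogeneous cycle, so it is the boundary of an element of degree `n` in
`F_{i+2}`; below the degrees of all generators there, that element is 0. -/
theorem GradedFreeComplex.IsMinimalFreeResolution.eq_of_d_eq {σ k : Type*} [Field k]
    {C : GradedFreeComplex σ k} {I : Ideal (MvPolynomial σ k)} (hC : C.IsMinimalFreeResolution I)
    {i : ℕ} {n : ℤ} (hn : ∀ b, C.hdeg b = i + 2 → n < C.deg b) {f g : C.Total}
    (hf : f ∈ C.hpart (i + 1)) (hg : g ∈ C.hpart (i + 1)) (hfn : C.IsHomogeneousOfDegree f n)
    (hgn : C.IsHomogeneousOfDegree g n) (h : C.d f = C.d g) : f = g := by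
  obtain ⟨t, ht, htn, htd⟩ := hC.exists_homogeneous_preimage (hfn.sub hgn)
    ((hC.exact i _ (Submodule.sub_mem _ hf hg)).1 (by rw [map_sub, h, sub_self]))
  have ht0 : t = 0 := by
    ext1 b
    by_contra hb
    exact absurd (htn.deg_le hb) (not_le.2 (hn b (ht (Finsupp.mem_support_iff.2 hb))))
  rw [ht0, map_zero] at htd
  exact (sub_eq_zero.1 htd.symm)

/-- The reversed lexicographic order, for which `x² ≺ xy ≺ y²z² ≺ zw ≺ w²`. -/
def katLt (u v : Fin 4 →₀ ℕ) : Prop := toLex v < toLex u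

instance : IsStrictTotalOrder (Fin 4 →₀ ℕ) katLt where
  irrefl u := lt_irrefl (toLex u)
  trans _ _ _ h h' := lt_trans (α := Lex (Fin 4 →₀ ℕ)) h' h
  trichotomous _ _ h h' := toLex.injective
    (le_antisymm (α := Lex (Fin 4 →₀ ℕ)) (not_lt.1 h) (not_lt.1 h'))

/-- With this order the signs can be computed on `Fin 5`. One convenient order suffices, since the
resolution is unique up to isomorphism. -/
theorem katLt_katGen_iff (i j : Fin 5) : katLt (katGen i) (katGen j) ↔ i < j := by
  have h : katLt (katGen i) (katGen j) ↔
      ∃ l, (∀ l' < l, katExp j l' = katExp i l') ∧ katExp j l < katExp i l := Finsupp.Lex.lt_iff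
  rw [h]
  clear h
  revert i j
  decide

theorem scarfSign_katGen (k : Type*) [Field k] (i : Fin 5) (s : Finset (Fin 5)) :
    scarfSign k katLt (katGen i) (s.map katGen) = (-1) ^ (s.filter (· < i)).card := by
  classical
  rw [scarfSign, Finset.filter_map, Finset.card_map]
  simp [katLt_katGen_iff]

/-! ### The Scarf complex of the ideal, indexed by subsets of `Fin 5`. -/

section KatthanComplex

variable {k : Type v} [Field k] {I : Ideal (MvPolynomial (Fin 4) k)}
  (hI : I = Ideal.span {X 0 ^ 2, X 0 * X 1, X 1 ^ 2 * X 2 ^ 2, X 2 * X 3, X 3 ^ 2})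

/-- The algebraic Scarf complex of the ideal. -/
noncomputable abbrev katComplex : GradedFreeComplex (Fin 4) k :=
  algebraicScarfComplex katLt I (katIdeal_ne_top hI)

/-- The basis element given by a set of generators, and zero if that set is not a face. -/
noncomputable def katBasis (s : Finset (Fin 5)) : (katComplex hI).Total :=
  if h : KatFace s then
    (katComplex hI).gen (scarfIndex katLt _ (s.map katGen) ((isScarfFace_map_katGen_iff hI).2 h))
  else 0

/-- The coefficients of the differential. -/
noncomputable def katCoeff (k : Type*) [Field k] (s : Finset (Fin 5)) (i : Fin 5) :
    MvPolynomial (Fin 4) k :=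
  (-1) ^ (s.filter (· < i)).card *
    ∏ j, X j ^ (s.sup katExp j - (s.erase i).sup katExp j)

theorem exists_eq_katBasis (x : (katComplex hI).B) : ∃ s, KatFace s ∧
    (katComplex hI).hdeg x = s.card ∧ (katComplex hI).deg x = ∑ j, s.sup katExp j ∧
    (katComplex hI).gen x = katBasis hI s := by
  have hx := isScarfFace_scarfSet x
  obtain ⟨s, hs⟩ := exists_map_katGen hI hx.1
  have hs' : KatFace s := (isScarfFace_map_katGen_iff hI).1 (hs ▸ hx)
  have hxs : x = scarfIndex katLt _ (s.map katGen) ((isScarfFace_map_katGen_iff hI).2 hs') :=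
    Subtype.ext hs
  refine ⟨s, hs', ?_, ?_, ?_⟩
  · rw [hxs]
    exact Finset.card_map _
  · rw [hxs]
    change ((lcmExp (s.map katGen)).degree : ℤ) = _
    rw [lcmExp_map_katGen, Finsupp.degree_eq_sum, Nat.cast_sum]
    simp
  · rw [katBasis, dif_pos hs', hxs]

theorem katBasis_mem_hpart (s : Finset (Fin 5)) :
    katBasis hI s ∈ (katComplex hI).hpart s.card := by
  rw [katBasis]
  split_ifs with h
  · refine Finsupp.single_mem_supported _ _ ?_
    exact Finset.card_map _
  · exact zero_mem _

theorem katBasis_homogeneous (s : Finset (Fin 5)) :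
    (katComplex hI).IsHomogeneousOfDegree (katBasis hI s) (∑ j, s.sup katExp j : ℕ) := by
  rw [katBasis]
  split_ifs with h
  · have := GradedFreeComplex.isHomogeneousOfDegree_gen (C := katComplex hI)
      (scarfIndex katLt _ (s.map katGen) ((isScarfFace_map_katGen_iff hI).2 h))
    convert this
    change ((∑ j, s.sup katExp j : ℕ) : ℤ) = ((lcmExp (s.map katGen)).degree : ℤ)
    rw [lcmExp_map_katGen, Finsupp.degree_eq_sum]
    rfl
  · exact .zero _

theorem katBasis_empty : katBasis hI ∅ = (katComplex hI).gen (katComplex hI).one := by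
  rw [katBasis, dif_pos (by decide)]
  rfl

theorem kat_d_katBasis {s : Finset (Fin 5)} (h : KatFace s) :
    (katComplex hI).d (katBasis hI s) = ∑ i ∈ s, katCoeff k s i • katBasis hI (s.erase i) := by
  classical
  have hs := (isScarfFace_map_katGen_iff hI).2 h
  rw [katBasis, dif_pos h, scarf_d_single, one_smul, Finset.sum_map]
  refine Finset.sum_congr rfl fun i _ => ?_
  have hi : KatFace (s.erase i) := by
    intro h2
    simp only [Finset.mem_erase] at h2 ⊢
    exact ⟨fun h0 => (h h2.2).1 h0.2, fun h4 => (h h2.2).2 h4.2⟩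
  -- Stated for every decidable equality, so that it applies to whichever instance the `erase` in
  -- the Scarf differential carries.
  have he : ∀ inst : DecidableEq (Fin 4 →₀ ℕ),
      @Finset.erase _ inst (s.map katGen) (katGen i) = (s.erase i).map katGen := fun inst => by
    rw [Finset.map_erase]
  rw [katBasis, dif_pos hi, ← GradedFreeComplex.single_eq_smul_gen, scarfSign_katGen]
  have hidx : scarfIndex katLt (katIdeal_ne_top hI) _ (hs.erase (katGen i)) =
      scarfIndex katLt (katIdeal_ne_top hI) ((s.erase i).map katGen)
        ((isScarfFace_map_katGen_iff hI).2 hi) := Subtype.ext (he _)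
  rw [hidx]
  congr 1
  rw [katCoeff, map_pow, map_neg, map_one]
  congr 1
  rw [he, lcmExp_map_katGen, lcmExp_map_katGen, monomial_eq, map_one, one_mul,
    Finsupp.prod_fintype _ _ fun i => pow_zero _]
  rfl

end KatthanComplex

/-! ### Explicit boundaries of all vertices, edges and triangles. -/

section KatthanComplex

variable {k : Type v} [Field k] {I : Ideal (MvPolynomial (Fin 4) k)}
  (hI : I = Ideal.span {X 0 ^ 2, X 0 * X 1, X 1 ^ 2 * X 2 ^ 2, X 2 * X 3, X 3 ^ 2})

theorem kat_d_0 : (katComplex hI).d (katBasis hI {0}) =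
      (X 0 ^ 2 : MvPolynomial (Fin 4) k) • katBasis hI ∅ := by
  rw [kat_d_katBasis hI (by decide)]
  simp [katCoeff, katExp, Fin.prod_univ_four, Finset.filter_singleton]

theorem kat_d_1 : (katComplex hI).d (katBasis hI {1}) =
      (X 0 * X 1 : MvPolynomial (Fin 4) k) • katBasis hI ∅ := by
  rw [kat_d_katBasis hI (by decide)]
  simp [katCoeff, katExp, Fin.prod_univ_four, Finset.filter_singleton]

theorem kat_d_2 : (katComplex hI).d (katBasis hI {2}) =
      (X 1 ^ 2 * X 2 ^ 2 : MvPolynomial (Fin 4) k) • katBasis hI ∅ := by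
  rw [kat_d_katBasis hI (by decide)]
  simp [katCoeff, katExp, Fin.prod_univ_four, Finset.filter_singleton]

theorem kat_d_3 : (katComplex hI).d (katBasis hI {3}) =
      (X 2 * X 3 : MvPolynomial (Fin 4) k) • katBasis hI ∅ := by
  rw [kat_d_katBasis hI (by decide)]
  simp [katCoeff, katExp, Fin.prod_univ_four, Finset.filter_singleton]

theorem kat_d_4 : (katComplex hI).d (katBasis hI {4}) =
      (X 3 ^ 2 : MvPolynomial (Fin 4) k) • katBasis hI ∅ := by
  rw [kat_d_katBasis hI (by decide)]
  simp [katCoeff, katExp, Fin.prod_univ_four, Finset.filter_singleton]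

theorem kat_d_01 : (katComplex hI).d (katBasis hI {0, 1}) =
      (X 0 : MvPolynomial (Fin 4) k) • katBasis hI {1} -
        (X 1 : MvPolynomial (Fin 4) k) • katBasis hI {0} := by
  rw [kat_d_katBasis hI (by decide)]
  simp [katCoeff, katExp, Fin.prod_univ_four, Finset.filter_insert, Finset.filter_singleton,
    Finset.erase_insert_eq_erase, Finset.erase_insert_of_ne, sub_eq_add_neg]

theorem kat_d_03 : (katComplex hI).d (katBasis hI {0, 3}) =
      (X 0 ^ 2 : MvPolynomial (Fin 4) k) • katBasis hI {3} -
        (X 2 * X 3 : MvPolynomial (Fin 4) k) • katBasis hI {0} := by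
  rw [kat_d_katBasis hI (by decide)]
  simp [katCoeff, katExp, Fin.prod_univ_four, Finset.filter_insert, Finset.filter_singleton,
    Finset.erase_insert_eq_erase, Finset.erase_insert_of_ne, sub_eq_add_neg]

theorem kat_d_04 : (katComplex hI).d (katBasis hI {0, 4}) =
      (X 0 ^ 2 : MvPolynomial (Fin 4) k) • katBasis hI {4} -
        (X 3 ^ 2 : MvPolynomial (Fin 4) k) • katBasis hI {0} := by
  rw [kat_d_katBasis hI (by decide)]
  simp [katCoeff, katExp, Fin.prod_univ_four, Finset.filter_insert, Finset.filter_singleton,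
    Finset.erase_insert_eq_erase, Finset.erase_insert_of_ne, sub_eq_add_neg]

theorem kat_d_12 : (katComplex hI).d (katBasis hI {1, 2}) =
      (X 0 : MvPolynomial (Fin 4) k) • katBasis hI {2} -
        (X 1 * X 2 ^ 2 : MvPolynomial (Fin 4) k) • katBasis hI {1} := by
  rw [kat_d_katBasis hI (by decide)]
  simp [katCoeff, katExp, Fin.prod_univ_four, Finset.filter_insert, Finset.filter_singleton,
    Finset.erase_insert_eq_erase, Finset.erase_insert_of_ne, sub_eq_add_neg]

theorem kat_d_13 : (katComplex hI).d (katBasis hI {1, 3}) =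
      (X 0 * X 1 : MvPolynomial (Fin 4) k) • katBasis hI {3} -
        (X 2 * X 3 : MvPolynomial (Fin 4) k) • katBasis hI {1} := by
  rw [kat_d_katBasis hI (by decide)]
  simp [katCoeff, katExp, Fin.prod_univ_four, Finset.filter_insert, Finset.filter_singleton,
    Finset.erase_insert_eq_erase, Finset.erase_insert_of_ne, sub_eq_add_neg]

theorem kat_d_14 : (katComplex hI).d (katBasis hI {1, 4}) =
      (X 0 * X 1 : MvPolynomial (Fin 4) k) • katBasis hI {4} -
        (X 3 ^ 2 : MvPolynomial (Fin 4) k) • katBasis hI {1} := by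
  rw [kat_d_katBasis hI (by decide)]
  simp [katCoeff, katExp, Fin.prod_univ_four, Finset.filter_insert, Finset.filter_singleton,
    Finset.erase_insert_eq_erase, Finset.erase_insert_of_ne, sub_eq_add_neg]

theorem kat_d_23 : (katComplex hI).d (katBasis hI {2, 3}) =
      (X 1 ^ 2 * X 2 : MvPolynomial (Fin 4) k) • katBasis hI {3} -
        (X 3 : MvPolynomial (Fin 4) k) • katBasis hI {2} := by
  rw [kat_d_katBasis hI (by decide)]
  simp [katCoeff, katExp, Fin.prod_univ_four, Finset.filter_insert, Finset.filter_singleton,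
    Finset.erase_insert_eq_erase, Finset.erase_insert_of_ne, sub_eq_add_neg]

theorem kat_d_34 : (katComplex hI).d (katBasis hI {3, 4}) =
      (X 2 : MvPolynomial (Fin 4) k) • katBasis hI {4} -
        (X 3 : MvPolynomial (Fin 4) k) • katBasis hI {3} := by
  rw [kat_d_katBasis hI (by decide)]
  simp [katCoeff, katExp, Fin.prod_univ_four, Finset.filter_insert, Finset.filter_singleton,
    Finset.erase_insert_eq_erase, Finset.erase_insert_of_ne, sub_eq_add_neg]

theorem kat_d_013 : (katComplex hI).d (katBasis hI {0, 1, 3}) =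
      (X 0 : MvPolynomial (Fin 4) k) • katBasis hI {1, 3} -
        (X 1 : MvPolynomial (Fin 4) k) • katBasis hI {0, 3} +
        (X 2 * X 3 : MvPolynomial (Fin 4) k) • katBasis hI {0, 1} := by
  rw [kat_d_katBasis hI (by decide)]
  simp [katCoeff, katExp, Fin.prod_univ_four, Finset.filter_insert, Finset.filter_singleton,
    Finset.erase_insert_eq_erase, Finset.erase_insert_of_ne, sub_eq_add_neg, add_assoc]

theorem kat_d_014 : (katComplex hI).d (katBasis hI {0, 1, 4}) =
      (X 0 : MvPolynomial (Fin 4) k) • katBasis hI {1, 4} -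
        (X 1 : MvPolynomial (Fin 4) k) • katBasis hI {0, 4} +
        (X 3 ^ 2 : MvPolynomial (Fin 4) k) • katBasis hI {0, 1} := by
  rw [kat_d_katBasis hI (by decide)]
  simp [katCoeff, katExp, Fin.prod_univ_four, Finset.filter_insert, Finset.filter_singleton,
    Finset.erase_insert_eq_erase, Finset.erase_insert_of_ne, sub_eq_add_neg, add_assoc]

theorem kat_d_034 : (katComplex hI).d (katBasis hI {0, 3, 4}) =
      (X 0 ^ 2 : MvPolynomial (Fin 4) k) • katBasis hI {3, 4} -
        (X 2 : MvPolynomial (Fin 4) k) • katBasis hI {0, 4} +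
        (X 3 : MvPolynomial (Fin 4) k) • katBasis hI {0, 3} := by
  rw [kat_d_katBasis hI (by decide)]
  simp [katCoeff, katExp, Fin.prod_univ_four, Finset.filter_insert, Finset.filter_singleton,
    Finset.erase_insert_eq_erase, Finset.erase_insert_of_ne, sub_eq_add_neg, add_assoc]

theorem kat_d_134 : (katComplex hI).d (katBasis hI {1, 3, 4}) =
      (X 0 * X 1 : MvPolynomial (Fin 4) k) • katBasis hI {3, 4} -
        (X 2 : MvPolynomial (Fin 4) k) • katBasis hI {1, 4} +
        (X 3 : MvPolynomial (Fin 4) k) • katBasis hI {1, 3} := by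
  rw [kat_d_katBasis hI (by decide)]
  simp [katCoeff, katExp, Fin.prod_univ_four, Finset.filter_insert, Finset.filter_singleton,
    Finset.erase_insert_eq_erase, Finset.erase_insert_of_ne, sub_eq_add_neg, add_assoc]

theorem kat_d_123 : (katComplex hI).d (katBasis hI {1, 2, 3}) =
      (X 0 : MvPolynomial (Fin 4) k) • katBasis hI {2, 3} -
        (X 1 * X 2 : MvPolynomial (Fin 4) k) • katBasis hI {1, 3} +
        (X 3 : MvPolynomial (Fin 4) k) • katBasis hI {1, 2} := by
  rw [kat_d_katBasis hI (by decide)]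
  simp [katCoeff, katExp, Fin.prod_univ_four, Finset.filter_insert, Finset.filter_singleton,
    Finset.erase_insert_eq_erase, Finset.erase_insert_of_ne, sub_eq_add_neg, add_assoc]

end KatthanComplex

/-! ### The products forced by degree reasons, and the contradiction. -/

section KatthanMultiplication

variable {k : Type v} [Field k] {I : Ideal (MvPolynomial (Fin 4) k)}
  (hI : I = Ideal.span {X 0 ^ 2, X 0 * X 1, X 1 ^ 2 * X 2 ^ 2, X 2 * X 3, X 3 ^ 2})

theorem kat_isMinimalFreeResolution : (katComplex hI).IsMinimalFreeResolution I :=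
  katIdeal_scarf_isMinimalFreeResolution hI _ katLt

set_option maxRecDepth 100000 in
theorem kat_deg_of_card_three (s : Finset (Fin 5)) :
    KatFace s → s.card = 3 → 4 < ∑ j, s.sup katExp j := by
  revert s
  decide

set_option maxRecDepth 100000 in
theorem kat_deg_of_card_four (s : Finset (Fin 5)) :
    KatFace s → s.card = 4 → 5 < ∑ j, s.sup katExp j := by
  revert s
  decide

set_option maxRecDepth 100000 in
theorem katFace_card_three (s : Finset (Fin 5)) : KatFace s → s.card = 3 →
    s = {0, 1, 3} ∨ s = {0, 1, 4} ∨ s = {0, 3, 4} ∨ s = {1, 3, 4} ∨ s = {1, 2, 3} := by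
  revert s
  decide

/-- Cycles of `F_2` are determined in degree 4. -/
theorem kat_eq_of_d_eq_two {f g : (katComplex hI).Total} (hf : f ∈ (katComplex hI).hpart 2)
    (hg : g ∈ (katComplex hI).hpart 2) (hf4 : (katComplex hI).IsHomogeneousOfDegree f 4)
    (hg4 : (katComplex hI).IsHomogeneousOfDegree g 4)
    (h : (katComplex hI).d f = (katComplex hI).d g) : f = g := by
  refine (kat_isMinimalFreeResolution hI).eq_of_d_eq (fun b hb => ?_) hf hg hf4 hg4 h
  obtain ⟨s, hs, h1, h2, -⟩ := exists_eq_katBasis hI b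
  rw [h2]
  exact_mod_cast kat_deg_of_card_three s hs (h1.symm.trans hb)

/-- Cycles of `F_3` are determined in degree 5. -/
theorem kat_eq_of_d_eq_three {f g : (katComplex hI).Total} (hf : f ∈ (katComplex hI).hpart 3)
    (hg : g ∈ (katComplex hI).hpart 3) (hf5 : (katComplex hI).IsHomogeneousOfDegree f 5)
    (hg5 : (katComplex hI).IsHomogeneousOfDegree g 5)
    (h : (katComplex hI).d f = (katComplex hI).d g) : f = g := by
  refine (kat_isMinimalFreeResolution hI).eq_of_d_eq (fun b hb => ?_) hf hg hf5 hg5 h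
  obtain ⟨s, hs, h1, h2, -⟩ := exists_eq_katBasis hI b
  rw [h2]
  exact_mod_cast kat_deg_of_card_four s hs (h1.symm.trans hb)

variable {hI}
  {mul : (katComplex hI).Total →ₗ[MvPolynomial (Fin 4) k] (katComplex hI).Total
    →ₗ[MvPolynomial (Fin 4) k] (katComplex hI).Total}

theorem kat_mul_homogeneous
    (hg : (katComplex hI).RespectsGrading mul) {s t : Finset (Fin 5)} {n : ℤ}
    (hn : ((∑ j, s.sup katExp j : ℕ) : ℤ) + (∑ j, t.sup katExp j : ℕ) = n) :
    (katComplex hI).IsHomogeneousOfDegree (mul (katBasis hI s) (katBasis hI t)) n :=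
  hn ▸ hg _ _ _ _ (katBasis_homogeneous hI s) (katBasis_homogeneous hI t)

variable (hm : (katComplex hI).IsDGA mul) (hg : (katComplex hI).RespectsGrading mul)

include hm

theorem kat_one_mul (s : Finset (Fin 5)) :
    mul (katBasis hI ∅) (katBasis hI s) = katBasis hI s := by
  rw [katBasis_empty]
  exact hm.one_mul (kat_isMinimalFreeResolution hI) (katBasis_mem_hpart hI s)

theorem kat_mul_one (s : Finset (Fin 5)) :
    mul (katBasis hI s) (katBasis hI ∅) = katBasis hI s := by
  rw [katBasis_empty]
  exact hm.mul_one (kat_isMinimalFreeResolution hI) (katBasis_mem_hpart hI s)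

theorem kat_leibniz (s : Finset (Fin 5)) (f : (katComplex hI).Total) :
    (katComplex hI).d (mul (katBasis hI s) f) = mul ((katComplex hI).d (katBasis hI s)) f +
      (-1 : MvPolynomial (Fin 4) k) ^ s.card • mul (katBasis hI s) ((katComplex hI).d f) :=
  hm.leibniz _ _ (katBasis_mem_hpart hI s) _

theorem kat_mul_mem_hpart (s t : Finset (Fin 5)) :
    mul (katBasis hI s) (katBasis hI t) ∈ (katComplex hI).hpart (s.card + t.card) :=
  hm.mul_hpart _ _ _ (katBasis_mem_hpart hI s) _ (katBasis_mem_hpart hI t)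

include hg

/-- Both sides have degree 4 in `F_2` and the same boundary. The factor x appears because lcm(x²,
xy) has degree only 3. -/
theorem kat_mul_01 : mul (katBasis hI {0}) (katBasis hI {1}) =
    (X 0 : MvPolynomial (Fin 4) k) • katBasis hI {0, 1} := by
  refine kat_eq_of_d_eq_two hI (kat_mul_mem_hpart hm _ _)
    (Submodule.smul_mem _ _ (katBasis_mem_hpart hI _)) (kat_mul_homogeneous hg (by decide))
    ((katBasis_homogeneous hI _).smul (isWeightedHomogeneous_X _ _ _) (by decide)) ?_
  simp only [kat_leibniz hm, kat_d_0, kat_d_1, kat_d_01, map_smul, LinearMap.smul_apply,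
    kat_one_mul hm, kat_mul_one hm, Finset.card_singleton]
  module

theorem kat_mul_34 : mul (katBasis hI {3}) (katBasis hI {4}) =
    (X 3 : MvPolynomial (Fin 4) k) • katBasis hI {3, 4} := by
  refine kat_eq_of_d_eq_two hI (kat_mul_mem_hpart hm _ _)
    (Submodule.smul_mem _ _ (katBasis_mem_hpart hI _)) (kat_mul_homogeneous hg (by decide))
    ((katBasis_homogeneous hI _).smul (isWeightedHomogeneous_X _ _ _) (by decide)) ?_
  simp only [kat_leibniz hm, kat_d_3, kat_d_4, kat_d_34, map_smul, LinearMap.smul_apply,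
    kat_one_mul hm, kat_mul_one hm, Finset.card_singleton]
  module

theorem kat_mul_03 : mul (katBasis hI {0}) (katBasis hI {3}) = katBasis hI {0, 3} := by
  refine kat_eq_of_d_eq_two hI (kat_mul_mem_hpart hm _ _) (katBasis_mem_hpart hI _)
    (kat_mul_homogeneous hg (by decide)) (katBasis_homogeneous hI _) ?_
  simp only [kat_leibniz hm, kat_d_0, kat_d_3, kat_d_03, map_smul, LinearMap.smul_apply,
    kat_one_mul hm, kat_mul_one hm, Finset.card_singleton]
  module

theorem kat_mul_04 : mul (katBasis hI {0}) (katBasis hI {4}) = katBasis hI {0, 4} := by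
  refine kat_eq_of_d_eq_two hI (kat_mul_mem_hpart hm _ _) (katBasis_mem_hpart hI _)
    (kat_mul_homogeneous hg (by decide)) (katBasis_homogeneous hI _) ?_
  simp only [kat_leibniz hm, kat_d_0, kat_d_4, kat_d_04, map_smul, LinearMap.smul_apply,
    kat_one_mul hm, kat_mul_one hm, Finset.card_singleton]
  module

theorem kat_mul_13 : mul (katBasis hI {1}) (katBasis hI {3}) = katBasis hI {1, 3} := by
  refine kat_eq_of_d_eq_two hI (kat_mul_mem_hpart hm _ _) (katBasis_mem_hpart hI _)
    (kat_mul_homogeneous hg (by decide)) (katBasis_homogeneous hI _) ?_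
  simp only [kat_leibniz hm, kat_d_1, kat_d_3, kat_d_13, map_smul, LinearMap.smul_apply,
    kat_one_mul hm, kat_mul_one hm, Finset.card_singleton]
  module

theorem kat_mul_14 : mul (katBasis hI {1}) (katBasis hI {4}) = katBasis hI {1, 4} := by
  refine kat_eq_of_d_eq_two hI (kat_mul_mem_hpart hm _ _) (katBasis_mem_hpart hI _)
    (kat_mul_homogeneous hg (by decide)) (katBasis_homogeneous hI _) ?_
  simp only [kat_leibniz hm, kat_d_1, kat_d_4, kat_d_14, map_smul, LinearMap.smul_apply,
    kat_one_mul hm, kat_mul_one hm, Finset.card_singleton]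
  module

/-- Obtained from the boundary, hence valid in characteristic 2 as well, where graded commutativity
would not give it. -/
theorem kat_mul_00 : mul (katBasis hI {0}) (katBasis hI {0}) = 0 := by
  refine kat_eq_of_d_eq_two hI (kat_mul_mem_hpart hm _ _) (zero_mem _)
    (kat_mul_homogeneous hg (by decide)) (.zero _) ?_
  simp only [kat_leibniz hm, kat_d_0, map_smul, LinearMap.smul_apply,
    kat_one_mul hm, kat_mul_one hm, Finset.card_singleton, map_zero]
  module

theorem kat_mul_44 : mul (katBasis hI {4}) (katBasis hI {4}) = 0 := by
  refine kat_eq_of_d_eq_two hI (kat_mul_mem_hpart hm _ _) (zero_mem _)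
    (kat_mul_homogeneous hg (by decide)) (.zero _) ?_
  simp only [kat_leibniz hm, kat_d_4, map_smul, LinearMap.smul_apply,
    kat_one_mul hm, kat_mul_one hm, Finset.card_singleton, map_zero]
  module

/-- Here g_ab has degree 3 and g_e degree 2, so the product has degree 5 in `F_3` and is fixed by
its boundary. -/
theorem kat_mul_01_4 : mul (katBasis hI {0, 1}) (katBasis hI {4}) = katBasis hI {0, 1, 4} := by
  refine kat_eq_of_d_eq_three hI (kat_mul_mem_hpart hm _ _) (katBasis_mem_hpart hI _)
    (kat_mul_homogeneous hg (by decide)) (katBasis_homogeneous hI _) ?_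
  have hc : ({0, 1} : Finset (Fin 5)).card = 2 := rfl
  simp only [kat_leibniz hm, kat_d_01, kat_d_4, kat_d_014, map_smul, map_sub,
    LinearMap.smul_apply, LinearMap.sub_apply, kat_mul_one hm, kat_mul_04 hm hg, kat_mul_14 hm hg,
    hc]
  module

theorem kat_mul_0_34 : mul (katBasis hI {0}) (katBasis hI {3, 4}) = katBasis hI {0, 3, 4} := by
  refine kat_eq_of_d_eq_three hI (kat_mul_mem_hpart hm _ _) (katBasis_mem_hpart hI _)
    (kat_mul_homogeneous hg (by decide)) (katBasis_homogeneous hI _) ?_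
  simp only [kat_leibniz hm, kat_d_0, kat_d_34, kat_d_034, map_smul, map_sub,
    LinearMap.smul_apply, kat_one_mul hm, kat_mul_03 hm hg, kat_mul_04 hm hg,
    Finset.card_singleton]
  module

/-- The two ways to compute `g_a g_c g_e` differ modulo `x` and `w`. -/
theorem kat_not_isDGA : False := by
  -- `ρ` sets x = w = 0. Its kernel `P` contains x and w but not yz², and `M` is `P` times the whole
  -- complex.
  let ρ : MvPolynomial (Fin 4) k →ₐ[k] MvPolynomial (Fin 4) k := aeval ![0, X 1, X 2, 0]
  let P : Ideal (MvPolynomial (Fin 4) k) := RingHom.ker ρ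
  let M : Submodule (MvPolynomial (Fin 4) k) (katComplex hI).Total := P • ⊤
  have hP : ∀ p ∈ P, ∀ y : (katComplex hI).Total ⧸ M, p • y = 0 := by
    intro p hp y
    obtain ⟨f, rfl⟩ := Submodule.Quotient.mk_surjective M y
    rw [← Submodule.Quotient.mk_smul, Submodule.Quotient.mk_eq_zero]
    exact Submodule.smul_mem_smul hp trivial
  have h0 := hP (X 0) (by simp [P, ρ, RingHom.mem_ker])
  have h3 := hP (X 3) (by simp [P, ρ, RingHom.mem_ker])
  have hq : ∀ f, M.mkQ f = 0 ↔ f ∈ M := fun f => Submodule.Quotient.mk_eq_zero M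
  -- The product g_a g_c has degree 6, where `F_3` is nonzero, so its boundary term is unknown and
  -- all five triangles must be treated. In each boundary the terms without a factor x or w are
  -- multiples of g_ad, g_bd, g_ae or g_be. Multiplied by g_e, the first two give a multiple of w
  -- through g_d g_e, and the last two give 0 through g_e g_e.
  have hT : ∀ T ∈ (katComplex hI).hpart 3,
      M.mkQ (mul ((katComplex hI).d T) (katBasis hI {4})) = 0 := by
    have h034 : M.mkQ (mul (katBasis hI {0, 3}) (katBasis hI {4})) = 0 := by
      rw [← kat_mul_03 hm hg, hm.assoc, kat_mul_34 hm hg, map_smul, map_smul, h3]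
    have h134 : M.mkQ (mul (katBasis hI {1, 3}) (katBasis hI {4})) = 0 := by
      rw [← kat_mul_13 hm hg, hm.assoc, kat_mul_34 hm hg, map_smul, map_smul, h3]
    have h044 : mul (katBasis hI {0, 4}) (katBasis hI {4}) = 0 := by
      rw [← kat_mul_04 hm hg, hm.assoc, kat_mul_44 hm hg, map_zero]
    have h144 : mul (katBasis hI {1, 4}) (katBasis hI {4}) = 0 := by
      rw [← kat_mul_14 hm hg, hm.assoc, kat_mul_44 hm hg, map_zero]
    intro T hT
    rw [hq]
    refine GradedFreeComplex.map_mem_of_gen (φ := mul.flip (katBasis hI {4}) ∘ₗ (katComplex hI).d)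
      (fun x hx => ?_) hT
    obtain ⟨s, hs, h1, -, h2⟩ := exists_eq_katBasis hI x
    rw [h2, LinearMap.comp_apply, LinearMap.flip_apply, ← hq]
    rcases katFace_card_three s hs (h1.symm.trans hx) with rfl | rfl | rfl | rfl | rfl <;>
    simp only [kat_d_013, kat_d_014, kat_d_034, kat_d_134, kat_d_123, map_add, map_sub, map_smul,
      LinearMap.add_apply, LinearMap.sub_apply, LinearMap.smul_apply, h034, h134, h044, h144,
      pow_two, mul_smul, h0, h3, smul_zero, map_zero, add_zero, sub_zero]
  -- The mirror image: left multiplication by g_a kills g_ad and g_ae, and gives multiples of x on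
  -- g_bd and g_be through g_a g_b.
  have hU : ∀ U ∈ (katComplex hI).hpart 3,
      M.mkQ (mul (katBasis hI {0}) ((katComplex hI).d U)) = 0 := by
    have h003 : mul (katBasis hI {0}) (katBasis hI {0, 3}) = 0 := by
      rw [← kat_mul_03 hm hg, ← hm.assoc, kat_mul_00 hm hg, map_zero, LinearMap.zero_apply]
    have h004 : mul (katBasis hI {0}) (katBasis hI {0, 4}) = 0 := by
      rw [← kat_mul_04 hm hg, ← hm.assoc, kat_mul_00 hm hg, map_zero, LinearMap.zero_apply]
    have h013 : M.mkQ (mul (katBasis hI {0}) (katBasis hI {1, 3})) = 0 := by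
      rw [← kat_mul_13 hm hg, ← hm.assoc, kat_mul_01 hm hg, map_smul, LinearMap.smul_apply,
        map_smul, h0]
    have h014 : M.mkQ (mul (katBasis hI {0}) (katBasis hI {1, 4})) = 0 := by
      rw [← kat_mul_14 hm hg, ← hm.assoc, kat_mul_01 hm hg, map_smul, LinearMap.smul_apply,
        map_smul, h0]
    intro U hU
    rw [hq]
    refine GradedFreeComplex.map_mem_of_gen (φ := mul (katBasis hI {0}) ∘ₗ (katComplex hI).d)
      (fun x hx => ?_) hU
    obtain ⟨s, hs, h1, -, h2⟩ := exists_eq_katBasis hI x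
    rw [h2, LinearMap.comp_apply, ← hq]
    rcases katFace_card_three s hs (h1.symm.trans hx) with rfl | rfl | rfl | rfl | rfl <;>
    simp only [kat_d_013, kat_d_014, kat_d_034, kat_d_134, kat_d_123, map_add, map_sub, map_smul,
      h003, h004, h013, h014,
      pow_two, mul_smul, h0, h3, smul_zero, add_zero, sub_zero]
  -- The explicit combinations have the boundaries that the Leibniz rule prescribes for g_a g_c and
  -- g_c g_e, so by exactness each product differs from its combination by a boundary.
  have hex := (kat_isMinimalFreeResolution hI).exact 1
  obtain ⟨T, hT3, hTd⟩ := (hex (mul (katBasis hI {0}) (katBasis hI {2}) -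
      ((X 1 * X 2 ^ 2 : MvPolynomial (Fin 4) k) • katBasis hI {0, 1} +
        (X 0 : MvPolynomial (Fin 4) k) • katBasis hI {1, 2}))
      (Submodule.sub_mem _ (kat_mul_mem_hpart hm {0} {2}) (Submodule.add_mem _
        (Submodule.smul_mem _ _ (katBasis_mem_hpart hI {0, 1}))
        (Submodule.smul_mem _ _ (katBasis_mem_hpart hI {1, 2}))))).1 (by
    simp only [kat_leibniz hm, kat_d_0, kat_d_2, kat_d_01, kat_d_12, map_smul, map_sub, map_add,
      LinearMap.smul_apply, kat_one_mul hm, kat_mul_one hm, Finset.card_singleton]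
    module)
  obtain ⟨U, hU3, hUd⟩ := (hex (mul (katBasis hI {2}) (katBasis hI {4}) -
      ((X 1 ^ 2 * X 2 : MvPolynomial (Fin 4) k) • katBasis hI {3, 4} +
        (X 3 : MvPolynomial (Fin 4) k) • katBasis hI {2, 3}))
      (Submodule.sub_mem _ (kat_mul_mem_hpart hm {2} {4}) (Submodule.add_mem _
        (Submodule.smul_mem _ _ (katBasis_mem_hpart hI {3, 4}))
        (Submodule.smul_mem _ _ (katBasis_mem_hpart hI {2, 3}))))).1 (by
    simp only [kat_leibniz hm, kat_d_2, kat_d_4, kat_d_34, kat_d_23, map_smul, map_sub, map_add,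
      LinearMap.smul_apply, kat_one_mul hm, kat_mul_one hm, Finset.card_singleton]
    module)
  have hassoc := congrArg M.mkQ (hm.assoc (katBasis hI {0}) (katBasis hI {2}) (katBasis hI {4}))
  rw [← sub_add_cancel (mul (katBasis hI {0}) (katBasis hI {2})), ← hTd,
    ← sub_add_cancel (mul (katBasis hI {2}) (katBasis hI {4})), ← hUd] at hassoc
  simp only [map_add, map_smul, LinearMap.add_apply, LinearMap.smul_apply, hT T hT3, hU U hU3, h0,
    h3, kat_mul_01_4 hm hg, kat_mul_0_34 hm hg, zero_add, add_zero] at hassoc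
  -- What remains is yz² g_abe − y²z g_ade ∈ `M`; its coordinate at g_abe would put yz² into `P`.
  rw [← map_smul, ← map_smul, ← sub_eq_zero, ← map_sub, hq] at hassoc
  have hcoord : ∀ f ∈ M, ∀ b, f b ∈ P := fun f hf b => by
    refine Submodule.smul_induction_on hf (fun p hp g _ => ?_) fun f g hf hg => P.add_mem hf hg
    exact P.mul_mem_right _ hp
  have hne : scarfIndex katLt (katIdeal_ne_top hI) (({0, 3, 4} : Finset (Fin 5)).map katGen)
      ((isScarfFace_map_katGen_iff hI).2 (by decide)) ≠
      scarfIndex katLt (katIdeal_ne_top hI) (({0, 1, 4} : Finset (Fin 5)).map katGen)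
      ((isScarfFace_map_katGen_iff hI).2 (by decide)) := fun h =>
    absurd (Finset.map_injective katGen (congrArg scarfSet h)) (by decide)
  have hc := hcoord _ hassoc (scarfIndex katLt _ (({0, 1, 4} : Finset (Fin 5)).map katGen)
    ((isScarfFace_map_katGen_iff hI).2 (by decide)))
  rw [katBasis, dif_pos (by decide), katBasis, dif_pos (by decide), Finsupp.sub_apply,
    Finsupp.smul_apply, Finsupp.smul_apply, Finsupp.single_eq_same,
    Finsupp.single_eq_of_ne hne.symm, smul_zero, sub_zero, smul_eq_mul, mul_one,
    RingHom.mem_ker] at hc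
  simp [ρ] at hc

end KatthanMultiplication

/-- Here `x, y, z, w` are the variables `X 0, X 1, X 2, X 3`. -/
theorem theorem5p1 (k : Type v) [Field k] (I : Ideal (MvPolynomial (Fin 4) k))
    (hI : I = Ideal.span {X 0 ^ 2, X 0 * X 1, X 1 ^ 2 * X 2 ^ 2, X 2 * X 3, X 3 ^ 2}) :
    IsStronglyGeneric I ∧
    (∃ hI' : I ≠ ⊤, ∀ lt : (Fin 4 →₀ ℕ) → (Fin 4 →₀ ℕ) → Prop, IsStrictTotalOrder _ lt →
      (algebraicScarfComplex lt I hI').IsMinimalFreeResolution I) ∧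
    ∀ C : GradedFreeComplex.{0, v, w} (Fin 4) k, C.IsMinimalFreeResolution I →
      ¬ ∃ mul : C.Total →ₗ[MvPolynomial (Fin 4) k] C.Total →ₗ[MvPolynomial (Fin 4) k] C.Total,
        C.IsDGA mul ∧ C.RespectsGrading mul := by
  refine ⟨katIdeal_isStronglyGeneric hI, ⟨katIdeal_ne_top hI, fun lt _ =>
    katIdeal_scarf_isMinimalFreeResolution hI _ lt⟩, ?_⟩
  rintro C hC ⟨mul, hm, hg⟩
  obtain ⟨Φ, hΦ⟩ := (kat_isMinimalFreeResolution hI).exists_isGradedIso hC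
  obtain ⟨mul', hm', hg'⟩ := hΦ.exists_isDGA hm hg
  exact kat_not_isDGA hm' hg'
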